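/- **Setting.** Let $N\ge 1$, let $X=(X_1,\dots,X_N)$ be independent random variables, $X_k$ taking values in a measurable space $\Lambda_k$ (with measurable singletons), and write $\Lambda=\prod_{j\in[N]}\Lambda_j$. All functions $f:\Lambda\to\mathbb R$ and sets $\Gamma\subseteq\Lambda$, $\Gamma_k\subseteq\Lambda_k$ below are measurable, and $\mu=\mathbb E f(X)$. For $A\subseteq\Lambda$, "$A$" also denotes the event $X\in A$. A *query strategy* exposes $X_{q_1},X_{q_2},\dots$, where $q_1\in[N]$ is fixed and each $q_i$ is a measurable function of the previously exposed values; in each step it exposes a new index or stops, and it stops only when no further value is needed: $f$ is *determined* by the strategy if $f(x)=f(y)$ whenever $y$ agrees with $x$ on the set $Q=Q(x)\subseteq[N]$ of indices queried at $x$. (At least one variable is always queried.) Let $\mathcal Q=\{Q(x):x\in\Lambda\}$, and for $a\in\mathbb R^N$ write $\Sigma_{\mathcal Q}(a_k)=\max_{Q\in\mathcal Q}\sum_{k\in Q}a_k$ and $M_{\mathcal Q}(a_k)=\max_{Q\in\mathcal Q}\max_{k\in Q}a_k$. Let $\phi(x)=(1+x)\log(1+x)-x$. We say that a probability satisfies $\mathrm{BB}(V,C,t)$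 if it is at most $\exp\left(-\frac{t^2}{2V+2Ct/3}\right)$ and at most $\exp\left(-\frac{V}{C^2}\,\phi\left(\frac{Ct}{V}\right)\right)$. Exponential bounds with a vanishing denominator are read as $0$ if $t>0$ and as $1$ if $t=0$; likewise for the second bound in $\mathrm{BB}$ if $V=0$. Lipschitz conditions, for real numbers $c_k$, and $d_k$ with $c_k\le d_k$, for all $k$ and all $x,\tilde x$ differing only in the $k$-th coordinate: - (L) $|f(x)-f(\tilde x)|\le c_k$; - (TL) $|f(x)-f(\tilde x)|\le c_k$ if $x\in\Gamma$, and $\le d_k$ otherwise; - (TL2) $|f(x)-f(\tilde x)|\le c_k$ if $x,\tilde x\in\Gamma$, and $\le d_k$ otherwise. **(A) Any strategy, no bad event.** Let $f$ be determined by a query strategy and let $t\ge 0$. 1. If (L) holds on $\Lambda$, then $\mathbb P(f(X)\ge\mu+t)\le\exp\left(-2t^2/\Sigma_{\mathcal Q}(c_k^2)\right)$. 2. If (L) holds on $\Lambda$ and $\Lambda_k=\{0,1\}$, $p_k=\mathbb P(X_k=1)$ for all $k$, then $\mathbb P(f(X)\ge\mu+t)$ satisfies $\mathrm{BB}(V,C,t)$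 with $V=\Sigma_{\mathcal Q}((1-p_k)p_kc_k^2)$ and $C=M_{\mathcal Q}(c_k)$. For general $\Lambda_k$ with $\max_{\eta\in\Lambda_k}\mathbb P(X_k=\eta)\ge 1-p_k$ the same holds with $V=\Sigma_{\mathcal Q}(p_kc_k^2)$. 3. Let $\Gamma=\prod_j\Gamma_j$, let (L) hold for all $x,\tilde x\in\Gamma$, and let $|f(x)-f(\tilde x)|\le s$ for all $x,\tilde x\in\Lambda$. Then, with $\Delta=s\,\mathbb P(X\notin\Gamma)$, $\mathbb P(f(X)\ge\mu+t+\Delta\text{ and }X\in\Gamma)\le\exp\left(-4t^2/(2\Sigma_{\mathcal Q}(c_k^2))\right)$. **(B) Any strategy, bad event.** Let $\Gamma\subseteq\Lambda$ and $\gamma_k=\gamma\in(0,1]$ for all $k$. For every query strategy there is an event $\mathcal B\subseteq\Lambda$ (depending on the strategy, the law of $X$, $\Gamma$ and $\gamma$ only, not on $f$, $c_k$, $d_k$, $t$) with $$\mathbb P(\mathcal B)\le\Sigma_{\mathcal Q}(\gamma_k^{-1})\cdot\mathbb P(X\notin\Gamma)\quad\text{and}\quad\neg\mathcal B\subseteq\Gamma$$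 such that for every $f$ determined by the strategy, all $c_k\le d_k$ and all $t\ge 0$ the following hold. Put $\Delta_k=c_k+e_k$. 1. If (TL) holds on $\Lambda$, then with $e_k=\gamma_k(d_k-c_k)$: (a) $\mathbb P(f(X)\ge\mu+t\text{ and }\neg\mathcal B)\le\exp\left(-t^2/(2\Sigma_{\mathcal Q}(\Delta_k^2))\right)$; (b) if $|\Lambda_k|=2$ for all $k$, the exponent in (a) may be multiplied by $4$; (c) if $\Lambda_k=\{0,1\}$ and $p_k=\mathbb P(X_k=1)$ for all $k$, the probability in (a) satisfies $\mathrm{BB}(V,C,t)$ with $V=\Sigma_{\mathcal Q}((1-p_k)p_k\Delta_k^2)$ and $C=M_{\mathcal Q}(\Delta_k)$; (d) for general $\Lambda_k$, if $p_k<1$ and $\max_{\eta\in\Lambda_k}\mathbb P(X_k=\eta)\ge 1-p_k$ for all $k$, the probability in (a) satisfies $\mathrm{BB}(V,C,t)$ with $V=\Sigma_{\mathcal Q}\left(p_k(c_k+e_k(1-p_k)^{-1})^2\right)$ and $C=M_{\mathcal Q}(\Delta_k)$. 2. If only (TL2) holds on $\Lambda$ and $\min_{\eta\in\Lambda_k}\mathbb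 P(X_k=\eta)\ge q_k>0$ for all $k$, then (a)-(d) hold with $e_k=2\gamma_k(d_k-c_k)q_k^{-1}$. 3. (Truncation) If $\Gamma\subseteq\prod_j\Gamma_j$, (TL) holds for all $x,\tilde x\in\prod_j\Gamma_j$, and $|f(x)-f(\tilde x)|\le s$ for all $x,\tilde x\in\Lambda$, then with $e_k=\gamma_k(d_k-c_k)$ and $\Delta=s\,\mathbb P(X\notin\Gamma)$, $\mathbb P(f(X)\ge\mu+t+\Delta\text{ and }\neg\mathcal B)\le\exp\left(-t^2/(2\Sigma_{\mathcal Q}(\Delta_k^2))\right)$. In (A)3 and (B)3 one may take $\Delta=0$ if $f(x)\ge f(\tilde x)$ whenever $x,\tilde x\in\Lambda$ differ only in a $k$-th coordinate with $x_k\notin\Gamma_k$ and $\tilde x_k\in\Gamma_k$. **(C) Monotone strategies.** For every $\Gamma\subseteq\Lambda$ and arbitrary $\gamma_k\in(0,1]$ there is an event $\mathcal B\subseteq\Lambda$ (depending on the law of $X$, $\Gamma$ and $(\gamma_k)$ only) with $\mathbb P(\mathcal B)\le\sum_{k\in[N]}\gamma_k^{-1}\cdot\mathbb P(X\notin\Gamma)$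 and $\neg\mathcal B\subseteq\Gamma$ such that all conclusions (B)1-3 hold simultaneously for all query strategies with $q_{i+1}\ge q_i$ in each step. Moreover, if $\Lambda_k=\{0,1\}$ for all $k$, $f:\Lambda\to\mathbb R$ and $\Gamma$ are both increasing or both decreasing, $t\ge0$ and $\mathbb P(\mathcal B)<1$, then $\mathbb P(f(X)\ge\mu+t)\le\mathbb P(f(X)\ge\mu+t\text{ and }\neg\mathcal B)/(1-\mathbb P(\mathcal B))$. -/

import Mathlib

open MeasureTheory ProbabilityTheory

namespace DynamicExposure

/-! ### Lipschitz conditions on a product of `N` sets -/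

/-- `x` and `y` differ only in the `k`-th coordinate. -/
def DifferOnlyAt {N : ℕ} {Λ : Fin N → Type*} (k : Fin N) (x y : ∀ j, Λ j) : Prop :=
  ∀ j, j ≠ k → x j = y j

/-- The Lipschitz condition (L) with constants `c`, for points of `A`. -/
def LipschitzOnSet {N : ℕ} {Λ : Fin N → Type*} (A : Set (∀ j, Λ j))
    (f : (∀ j, Λ j) → ℝ) (c : Fin N → ℝ) : Prop :=
  ∀ k, ∀ x ∈ A, ∀ y ∈ A, DifferOnlyAt k x y → |f x - f y| ≤ c k

/-- The (one-sided) typical Lipschitz condition (TL), for points of `A`. -/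
def TypicalLipschitzOn {N : ℕ} {Λ : Fin N → Type*} (A Γ : Set (∀ j, Λ j))
    (f : (∀ j, Λ j) → ℝ) (c d : Fin N → ℝ) : Prop :=
  (∀ k, c k ≤ d k) ∧
    ∀ k, ∀ x ∈ A, ∀ y ∈ A, DifferOnlyAt k x y →
      (x ∈ Γ → |f x - f y| ≤ c k) ∧ (x ∉ Γ → |f x - f y| ≤ d k)

/-- The two-sided typical Lipschitz condition. -/
def TwoSidedTypicalLipschitz {N : ℕ} {Λ : Fin N → Type*} (Γ : Set (∀ j, Λ j))
    (f : (∀ j, Λ j) → ℝ) (c d : Fin N → ℝ) : Prop :=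
  (∀ k, c k ≤ d k) ∧
    ∀ k x y, DifferOnlyAt k x y →
      (x ∈ Γ ∧ y ∈ Γ → |f x - f y| ≤ c k) ∧ (¬ (x ∈ Γ ∧ y ∈ Γ) → |f x - f y| ≤ d k)

/-- Moving a single coordinate from outside `G k` into `G k` does not increase `f`. -/
def TruncationDecreases {N : ℕ} {Λ : Fin N → Type*} (G : ∀ k, Set (Λ k))
    (f : (∀ j, Λ j) → ℝ) : Prop :=
  ∀ k x y, DifferOnlyAt k x y → x k ∉ G k → y k ∈ G k → f y ≤ f x

/-- The coordinatewise order when each `Λ k` has two elements, of which `one k` is called `1`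
and the other one is called `0`. -/
def ZeroOneLE {N : ℕ} {Λ : Fin N → Type*} (one x y : ∀ k, Λ k) : Prop :=
  ∀ k, x k = one k → y k = one k

/-- `f` and `Γ` are both increasing or both decreasing in the `0`-`1` order. -/
def SameMonotonicity {N : ℕ} {Λ : Fin N → Type*} (one : ∀ k, Λ k) (Γ : Set (∀ j, Λ j))
    (f : (∀ j, Λ j) → ℝ) : Prop :=
  (∀ x y, ZeroOneLE one x y → f x ≤ f y ∧ (x ∈ Γ → y ∈ Γ)) ∨
    (∀ x y, ZeroOneLE one x y → f y ≤ f x ∧ (y ∈ Γ → x ∈ Γ))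

/-! ### Query strategies -/

/-- An adaptive query strategy: `query i x` is the index exposed in step `i` (steps are numbered
from `0`) when the outcome is `x`. It depends only on the values exposed before. In every step
either a new index is exposed, or the strategy has stopped, which is expressed by repeating the
last index from then on. -/
structure QueryStrategy {N : ℕ} (Λ : Fin N → Type*) [∀ k, MeasurableSpace (Λ k)] where
  query : ℕ → (∀ k, Λ k) → Fin N
  measurable_query : ∀ i, Measurable (query i)
  adapted : ∀ i x y, (∀ j < i, x (query j x) = y (query j x)) → query i x = query i y
  fresh_or_stopped : ∀ i x,
    (∀ j ≤ i, query (i + 1) x ≠ query j x) ∨ (∀ m ≥ i, query m x = query i x)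

namespace QueryStrategy

open Classical in
/-- The set `Q` of indices exposed when the outcome is `x`. -/
noncomputable def queried {N : ℕ} {Λ : Fin N → Type*} [∀ k, MeasurableSpace (Λ k)]
    (σ : QueryStrategy Λ) (x : ∀ k, Λ k) : Finset (Fin N) :=
  Finset.univ.filter fun k => ∃ i, σ.query i x = k

/-- The family `𝒬` of all possible query sets. -/
def querySets {N : ℕ} {Λ : Fin N → Type*} [∀ k, MeasurableSpace (Λ k)]
    (σ : QueryStrategy Λ) : Set (Finset (Fin N)) :=
  Set.range σ.queried

/-- The exposed values determine the value of `f`. -/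
def Determines {N : ℕ} {Λ : Fin N → Type*} [∀ k, MeasurableSpace (Λ k)]
    (σ : QueryStrategy Λ) (f : (∀ k, Λ k) → ℝ) : Prop :=
  ∀ x y, (∀ k ∈ σ.queried x, x k = y k) → f x = f y

/-- The indices are exposed in increasing order. -/
def IsMonotone {N : ℕ} {Λ : Fin N → Type*} [∀ k, MeasurableSpace (Λ k)]
    (σ : QueryStrategy Λ) : Prop :=
  ∀ i x, σ.query i x ≤ σ.query (i + 1) x

/-- `max_{Q ∈ 𝒬} ∑_{k ∈ Q} a k`. -/
noncomputable def maxSum {N : ℕ} {Λ : Fin N → Type*} [∀ k, MeasurableSpace (Λ k)]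
    (σ : QueryStrategy Λ) (a : Fin N → ℝ) : ℝ :=
  ⨆ Q : σ.querySets, ∑ k ∈ (Q : Finset (Fin N)), a k

/-- `max_{Q ∈ 𝒬} max_{k ∈ Q} a k`. -/
noncomputable def maxMax {N : ℕ} {Λ : Fin N → Type*} [∀ k, MeasurableSpace (Λ k)]
    (σ : QueryStrategy Λ) (a : Fin N → ℝ) : ℝ :=
  ⨆ Q : σ.querySets, ⨆ k : (Q : Finset (Fin N)), a k

end QueryStrategy

/-! ### The bounds -/

/-- `exp (-a / b)` for `a ≥ 0`, with `a / 0 = ∞` for `a ≠ 0` and `0 / 0 = 0`. -/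
noncomputable def expNegDiv (a b : ℝ) : ℝ :=
  if b = 0 then (if a = 0 then 1 else 0) else Real.exp (-(a / b))

/-- The Bernstein bound `exp (-t² / (2 V + 2 C t / 3))`. -/
noncomputable def bernsteinBound (V C t : ℝ) : ℝ :=
  expNegDiv (t ^ 2) (2 * V + 2 * C * t / 3)

/-- `φ(x) = (1 + x) log (1 + x) - x`. -/
noncomputable def phi (x : ℝ) : ℝ := (1 + x) * Real.log (1 + x) - x

/-- The Bennett bound `exp (-(V / C²) φ(C t / V))`, read as its limit for `V → 0` if `V = 0`. -/
noncomputable def bennettBound (V C t : ℝ) : ℝ :=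
  if V = 0 then (if t = 0 then 1 else 0) else Real.exp (-(V / C ^ 2 * phi (C * t / V)))

/-! ### The tail estimates -/

/-- The probability that `f(X) ≥ 𝔼 f(X) + s` and `X ∉ B`. -/
noncomputable def tailOff {N : ℕ} {Λ : Fin N → Type*} {Ω : Type*} [MeasurableSpace Ω]
    (P : Measure Ω) (X : ∀ k, Ω → Λ k) (f : (∀ k, Λ k) → ℝ) (B : Set (∀ k, Λ k)) (s : ℝ) : ℝ :=
  P.real {ω | (∫ ω', f (fun k => X k ω') ∂P) + s ≤ f (fun k => X k ω) ∧ (fun k => X k ω) ∉ B}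

/-- The probability that `f(X) ≥ 𝔼 f(X) + s`. -/
noncomputable def tail {N : ℕ} {Λ : Fin N → Type*} {Ω : Type*} [MeasurableSpace Ω]
    (P : Measure Ω) (X : ∀ k, Ω → Λ k) (f : (∀ k, Λ k) → ℝ) (s : ℝ) : ℝ :=
  P.real {ω | (∫ ω', f (fun k => X k ω') ∂P) + s ≤ f (fun k => X k ω)}

/-- The probability that `X ∈ A`. -/
noncomputable def probIn {N : ℕ} {Λ : Fin N → Type*} {Ω : Type*} [MeasurableSpace Ω]
    (P : Measure Ω) (X : ∀ k, Ω → Λ k) (A : Set (∀ k, Λ k)) : ℝ :=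
  P.real {ω | (fun k => X k ω) ∈ A}

/-- The admissible values of the correction term in the inequality with truncation: always
`s · ℙ(X ∉ Γ)`, and also `0` if truncation decreases `f`. -/
def IsTruncationError {N : ℕ} {Λ : Fin N → Type*} {Ω : Type*} [MeasurableSpace Ω]
    (P : Measure Ω) (X : ∀ k, Ω → Λ k) (Γ : Set (∀ k, Λ k)) (G : ∀ k, Set (Λ k))
    (f : (∀ k, Λ k) → ℝ) (s δ : ℝ) : Prop :=
  δ = s * probIn P X Γᶜ ∨ (δ = 0 ∧ TruncationDecreases G f)

/-- The inequalities without a bad event, for the strategy `σ`. -/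
def BoundedDifferencesTails {N : ℕ} {Λ : Fin N → Type*} [∀ k, MeasurableSpace (Λ k)]
    {Ω : Type*} [MeasurableSpace Ω] (P : Measure Ω) (X : ∀ k, Ω → Λ k)
    (σ : QueryStrategy Λ) : Prop :=
  ∀ f : (∀ k, Λ k) → ℝ, Measurable f → σ.Determines f → ∀ (c : Fin N → ℝ) (t : ℝ), 0 ≤ t →
    (LipschitzOnSet Set.univ f c →
      -- the bounded differences inequality
      (tail P X f t ≤ expNegDiv (2 * t ^ 2) (σ.maxSum fun k => c k ^ 2)) ∧
      -- `0`-`1` variables, with `p k = ℙ(X k = 1)`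
      (∀ one : ∀ k, Λ k, (∀ k, Nat.card (Λ k) = 2) →
        ∀ p : Fin N → ℝ, (∀ k, p k = P.real {ω | X k ω = one k}) →
          tail P X f t ≤
            bernsteinBound (σ.maxSum fun k => (1 - p k) * p k * c k ^ 2) (σ.maxMax c) t ∧
          tail P X f t ≤
            bennettBound (σ.maxSum fun k => (1 - p k) * p k * c k ^ 2) (σ.maxMax c) t) ∧
      -- general variables with `max_η ℙ(X k = η) ≥ 1 - p k`
      (∀ p : Fin N → ℝ, (∀ k, ∃ η, 1 - p k ≤ P.real {ω | X k ω = η}) →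
        tail P X f t ≤ bernsteinBound (σ.maxSum fun k => p k * c k ^ 2) (σ.maxMax c) t ∧
        tail P X f t ≤ bennettBound (σ.maxSum fun k => p k * c k ^ 2) (σ.maxMax c) t)) ∧
    -- truncation with the good event `∏ k, G k`, whose complement is the bad event
    (∀ G : ∀ k, Set (Λ k), (∀ k, MeasurableSet (G k)) →
      LipschitzOnSet (Set.univ.pi G) f c →
      ∀ s : ℝ, (∀ x y, |f x - f y| ≤ s) →
      ∀ δ : ℝ, IsTruncationError P X (Set.univ.pi G) G f s δ →
        tailOff P X f (Set.univ.pi G)ᶜ (t + δ) ≤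
          expNegDiv (4 * t ^ 2) (2 * σ.maxSum fun k => c k ^ 2))

/-- The inequalities for `f` off the bad event `B`, with coefficients `c k` and error
terms `e k`. -/
def TailsOff {N : ℕ} {Λ : Fin N → Type*} [∀ k, MeasurableSpace (Λ k)]
    {Ω : Type*} [MeasurableSpace Ω] (P : Measure Ω) (X : ∀ k, Ω → Λ k)
    (σ : QueryStrategy Λ) (B : Set (∀ k, Λ k)) (f : (∀ k, Λ k) → ℝ)
    (c e : Fin N → ℝ) : Prop :=
  ∀ t : ℝ, 0 ≤ t →
    -- general variables
    (tailOff P X f B t ≤ expNegDiv (t ^ 2) (2 * σ.maxSum fun k => (c k + e k) ^ 2)) ∧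
    -- two-valued variables
    ((∀ k, Nat.card (Λ k) = 2) →
      tailOff P X f B t ≤ expNegDiv (4 * t ^ 2) (2 * σ.maxSum fun k => (c k + e k) ^ 2)) ∧
    -- `0`-`1` variables, with `p k = ℙ(X k = 1)`
    (∀ one : ∀ k, Λ k, (∀ k, Nat.card (Λ k) = 2) →
      ∀ p : Fin N → ℝ, (∀ k, p k = P.real {ω | X k ω = one k}) →
        tailOff P X f B t ≤
          bernsteinBound (σ.maxSum fun k => (1 - p k) * p k * (c k + e k) ^ 2)
            (σ.maxMax fun k => c k + e k) t ∧
        tailOff P X f B t ≤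
          bennettBound (σ.maxSum fun k => (1 - p k) * p k * (c k + e k) ^ 2)
            (σ.maxMax fun k => c k + e k) t) ∧
    -- general variables with `max_η ℙ(X k = η) ≥ 1 - p k`
    (∀ p : Fin N → ℝ, (∀ k, p k < 1 ∧ ∃ η, 1 - p k ≤ P.real {ω | X k ω = η}) →
        tailOff P X f B t ≤
          bernsteinBound (σ.maxSum fun k => p k * (c k + e k * (1 - p k)⁻¹) ^ 2)
            (σ.maxMax fun k => c k + e k) t ∧
        tailOff P X f B t ≤
          bennettBound (σ.maxSum fun k => p k * (c k + e k * (1 - p k)⁻¹) ^ 2)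
            (σ.maxMax fun k => c k + e k) t)

/-- The inequalities with good event `Γ`, compensation factors `γ` and bad event `B`, for the
strategy `σ` and all functions `f` determined by it. -/
def TypicalTails {N : ℕ} {Λ : Fin N → Type*} [∀ k, MeasurableSpace (Λ k)]
    {Ω : Type*} [MeasurableSpace Ω] (P : Measure Ω) (X : ∀ k, Ω → Λ k)
    (σ : QueryStrategy Λ) (Γ : Set (∀ k, Λ k)) (γ : Fin N → ℝ) (B : Set (∀ k, Λ k)) : Prop :=
  ∀ f : (∀ k, Λ k) → ℝ, Measurable f → σ.Determines f → ∀ c d : Fin N → ℝ,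
    -- one-sided typical Lipschitz condition
    (TypicalLipschitzOn Set.univ Γ f c d →
      TailsOff P X σ B f c (fun k => γ k * (d k - c k))) ∧
    -- two-sided typical Lipschitz condition
    (TwoSidedTypicalLipschitz Γ f c d →
      ∀ q : Fin N → ℝ, (∀ k, 0 < q k ∧ ∀ η, q k ≤ P.real {ω | X k ω = η}) →
        TailsOff P X σ B f c (fun k => 2 * γ k * (d k - c k) * (q k)⁻¹)) ∧
    -- truncation
    (∀ G : ∀ k, Set (Λ k), (∀ k, MeasurableSet (G k)) → Γ ⊆ Set.univ.pi G →
      TypicalLipschitzOn (Set.univ.pi G) Γ f c d →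
      ∀ s : ℝ, (∀ x y, |f x - f y| ≤ s) →
      ∀ δ : ℝ, IsTruncationError P X Γ G f s δ →
      ∀ t : ℝ, 0 ≤ t →
        tailOff P X f B (t + δ) ≤
          expNegDiv (t ^ 2) (2 * σ.maxSum fun k => (c k + γ k * (d k - c k)) ^ 2))

end DynamicExposure

/-! Under the joint law, a product measure `Measure.pi ν`, the means of `f` given the coordinates
exposed so far (`condMean`) form a Doob martingale along any exposure `τ`. It starts at the mean of
`f` and has reached `f` once all queries of the strategy `σ` that determines `f` are exposed. Every
tail bound is a Chernoff bound for this martingale. The process `exp (lam * condMean - ∑ v k)` is a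
supermartingale as long as the moment generating function of each increment is at most `exp (v k)`.
The sum runs only over exposed indices that `σ` queries, so at the end it is a sum over one query
set. This needs to be known before a coordinate is exposed, and the increments at all other indices
need to vanish: this is what `Refines σ τ` provides. It holds for `τ = σ`. It also holds for the
natural order if `σ` is monotone, because whether such a `σ` asks `k` depends only on the
coordinates below `k`. Hence a single bad event, built from the natural order, serves all monotone
strategies.

The process is killed as soon as the conditional probability of the complement of `Γ` exceeds `γ k`
when `k` is about to be exposed (`goodAt`). Before that, increments are controlled by `c k + (d k -
c k) * φ`, where `φ` is the conditional probability of failure given the new value, with mean at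
most `γ k` (`TypicalIncrement`). Averaging `φ`, taking its minimum over two points, or evaluating it
at a heavy atom gives the various error terms (`ControlledIncrement`). The one-step estimates are
Hoeffding's lemma and a Bennett bound; optimising over `lam` yields the stated forms. The bad event
is small by Markov's inequality, because the conditional probability of failure has mean `ℙ(X ∉ Γ)`
at every step (`measureReal_badEvent_le`).

Truncation conditions the law on a box. It stays a product measure, `Γ` only becomes more likely at
every step (`condBad_cond_le`), and the change of the mean is the correction term. The final
inequality for monotone `f` and `Γ` is Harris's inequality, since off the bad event all conditions
are monotone. -/

namespace DynamicExposure

/-! ### Conditional means under a product measure -/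

section ProductMeasure

variable {N : ℕ} {Λ : Fin N → Type*} [∀ k, MeasurableSpace (Λ k)]

lemma measurable_update_pair (k : Fin N) :
    Measurable fun p : (∀ j, Λ j) × Λ k => Function.update p.1 k p.2 := by
  refine measurable_pi_lambda _ fun j => ?_
  by_cases h : j = k
  · subst h; simpa using measurable_snd
  · simpa [h, Function.comp_def] using (measurable_pi_apply j).comp measurable_fst

lemma measurable_piecewise_pair (S : Finset (Fin N)) :
    Measurable fun p : (∀ j, Λ j) × (∀ j, Λ j) => S.piecewise p.1 p.2 := by
  refine measurable_pi_lambda _ fun j => ?_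
  by_cases h : j ∈ S
  · simpa [h, Function.comp_def] using (measurable_pi_apply j).comp measurable_fst
  · simpa [h, Function.comp_def] using (measurable_pi_apply j).comp measurable_snd

variable (ν : ∀ k, Measure (Λ k)) {F : (∀ k, Λ k) → ℝ} {K : ℝ}

/-- The conditional mean of `F` given the coordinates in `S`. -/
noncomputable def condMean (F : (∀ k, Λ k) → ℝ) (S : Finset (Fin N)) (x : ∀ k, Λ k) : ℝ :=
  ∫ y, F (S.piecewise x y) ∂Measure.pi ν

/-- The conditional mean of `F` given the coordinates in `S` and the value `a` of the `k`-th
coordinate. -/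
noncomputable def fibreMean (F : (∀ k, Λ k) → ℝ) (S : Finset (Fin N)) (x : ∀ k, Λ k) (k : Fin N)
    (a : Λ k) : ℝ :=
  ∫ y, F (Function.update (S.piecewise x y) k a) ∂Measure.pi ν

lemma condMean_congr {S : Finset (Fin N)} {x z : ∀ k, Λ k} (h : ∀ j ∈ S, x j = z j) :
    condMean ν F S x = condMean ν F S z := by
  unfold condMean
  congr 1
  ext y
  rw [S.piecewise_congr h fun _ _ => rfl]

lemma condMean_insert {S : Finset (Fin N)} {k : Fin N} (hk : k ∉ S) (x : ∀ j, Λ j) (a : Λ k) :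
    condMean ν F (insert k S) (Function.update x k a) = fibreMean ν F S x k a := by
  unfold condMean fibreMean
  congr 1
  ext y
  congr 1
  rw [Finset.piecewise_insert, Function.update_self]
  congr 1
  exact S.piecewise_congr (fun j hj => by
    simp [Function.update_of_ne (ne_of_mem_of_not_mem hj hk)]) fun _ _ => rfl

lemma condMean_empty (x : ∀ k, Λ k) : condMean ν F ∅ x = ∫ y, F y ∂Measure.pi ν := by
  simp [condMean]

variable [∀ k, IsProbabilityMeasure (ν k)]

/-- Two independent copies of a product measure may be spliced together along `S`. -/
lemma measurePreserving_piecewise (S : Finset (Fin N)) :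
    MeasurePreserving (fun p : (∀ j, Λ j) × (∀ j, Λ j) => S.piecewise p.1 p.2)
      ((Measure.pi ν).prod (Measure.pi ν)) (Measure.pi ν) := by
  refine ⟨measurable_piecewise_pair S, (Measure.pi_eq fun s hs => ?_).symm⟩
  rw [Measure.map_apply (measurable_piecewise_pair S) (.univ_pi hs)]
  have : (fun p : (∀ j, Λ j) × (∀ j, Λ j) => S.piecewise p.1 p.2) ⁻¹' Set.univ.pi s =
      (Set.univ.pi fun j => if j ∈ S then s j else Set.univ) ×ˢ
        (Set.univ.pi fun j => if j ∈ S then Set.univ else s j) := by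
    ext ⟨x, y⟩
    simp only [Set.mem_preimage, Set.mem_univ_pi, Set.mem_prod, ← forall_and]
    refine forall_congr' fun j => ?_
    by_cases h : j ∈ S <;> simp [h]
  rw [this, Measure.prod_prod, Measure.pi_pi, Measure.pi_pi, ← Finset.prod_mul_distrib]
  refine Finset.prod_congr rfl fun j _ => ?_
  by_cases h : j ∈ S <;> simp [h]

/-- Resampling one coordinate does not change a product measure. -/
lemma measurePreserving_update (k : Fin N) :
    MeasurePreserving (fun p : (∀ j, Λ j) × Λ k => Function.update p.1 k p.2)
      ((Measure.pi ν).prod (ν k)) (Measure.pi ν) := by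
  refine ⟨measurable_update_pair k, (Measure.pi_eq fun s hs => ?_).symm⟩
  rw [Measure.map_apply (measurable_update_pair k) (.univ_pi hs)]
  have : (fun p : (∀ j, Λ j) × Λ k => Function.update p.1 k p.2) ⁻¹' Set.univ.pi s =
      (Set.univ.pi (Function.update s k Set.univ)) ×ˢ s k := by
    ext ⟨x, a⟩
    simp only [Set.mem_preimage, Set.mem_univ_pi, Set.mem_prod]
    constructor
    · refine fun h => ⟨fun j => ?_, by simpa using h k⟩
      by_cases hj : j = k
      · subst hj; simp
      · simpa [hj] using h j
    · rintro ⟨h, ha⟩ j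
      by_cases hj : j = k
      · subst hj; simpa using ha
      · simpa [hj] using h j
  rw [this, Measure.prod_prod, Measure.pi_pi, ← Finset.mul_prod_erase _ _ (Finset.mem_univ k),
    ← Finset.mul_prod_erase _ _ (Finset.mem_univ k)]
  simp only [Function.update_self, measure_univ, one_mul]
  rw [mul_comm]
  congr 1
  refine Finset.prod_congr rfl fun j hj => ?_
  simp [Finset.ne_of_mem_erase hj]

lemma abs_integral_le_of_abs_le {α : Type*} [MeasurableSpace α] (ρ : Measure α)
    [IsProbabilityMeasure ρ] {h : α → ℝ} (hK : ∀ a, |h a| ≤ K) : |∫ a, h a ∂ρ| ≤ K := by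
  have := norm_integral_le_of_norm_le_const (μ := ρ) (f := h) (C := K) (.of_forall hK)
  simpa using this

lemma integrable_of_abs_le {α : Type*} [MeasurableSpace α] {ρ : Measure α}
    [IsFiniteMeasure ρ] {h : α → ℝ} (hm : Measurable h) (hK : ∀ a, |h a| ≤ K) :
    Integrable h ρ :=
  Integrable.of_bound hm.aestronglyMeasurable K (.of_forall hK)

lemma abs_condMean_le (hK : ∀ x, |F x| ≤ K) (S : Finset (Fin N)) (x : ∀ k, Λ k) :
    |condMean ν F S x| ≤ K :=
  abs_integral_le_of_abs_le _ fun _ => hK _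

lemma abs_fibreMean_le (hK : ∀ x, |F x| ≤ K) (S : Finset (Fin N)) (x : ∀ k, Λ k) (k : Fin N)
    (a : Λ k) : |fibreMean ν F S x k a| ≤ K :=
  abs_integral_le_of_abs_le _ fun _ => hK _

lemma measurable_condMean (hF : Measurable F) (S : Finset (Fin N)) :
    Measurable (condMean ν F S) :=
  (StronglyMeasurable.integral_prod_right (ν := Measure.pi ν)
    (f := fun x y => F (S.piecewise x y))
    (hF.comp (measurable_piecewise_pair S)).stronglyMeasurable).measurable

lemma measurable_fibreMean (hF : Measurable F) (S : Finset (Fin N)) (x : ∀ k, Λ k)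
    (k : Fin N) : Measurable (fibreMean ν F S x k) := by
  have h : Measurable fun p : Λ k × (∀ j, Λ j) =>
      F (Function.update (S.piecewise x p.2) k p.1) :=
    hF.comp ((measurable_update_pair k).comp
      (((measurable_piecewise_pair S).comp (measurable_const.prodMk measurable_snd)).prodMk
        measurable_fst))
  exact (StronglyMeasurable.integral_prod_right (ν := Measure.pi ν)
    (f := fun a y => F (Function.update (S.piecewise x y) k a)) h.stronglyMeasurable).measurable

/-- The martingale property: for `k ∉ S` the update commutes with the splice, and resampling
coordinate `k` preserves the law, so Fubini applies. -/
lemma integral_fibreMean (hF : Measurable F) (hK : ∀ x, |F x| ≤ K) {S : Finset (Fin N)}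
    {k : Fin N} (hk : k ∉ S) (x : ∀ j, Λ j) :
    ∫ a, fibreMean ν F S x k a ∂ν k = condMean ν F S x := by
  have hm : Measurable fun y => F (S.piecewise x y) :=
    hF.comp ((measurable_piecewise_pair S).comp measurable_prodMk_left)
  have hi : Integrable (fun p : (∀ j, Λ j) × Λ k =>
      F (S.piecewise x (Function.update p.1 k p.2))) ((Measure.pi ν).prod (ν k)) :=
    integrable_of_abs_le (hm.comp (measurable_update_pair k)) fun _ => hK _
  unfold condMean
  rw [← (measurePreserving_update ν k).map_eq, integral_map (measurable_update_pair k).aemeasurable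
    hm.aestronglyMeasurable, integral_prod_symm _ hi]
  congr 1
  ext a
  unfold fibreMean
  congr 1
  ext y
  rw [Finset.update_piecewise_of_notMem _ _ _ hk]

/-- A product over all coordinates is integrated by resampling the `k`-th one. -/
lemma lintegral_pi_update (k : Fin N) {H : (∀ j, Λ j) → ENNReal} (hH : Measurable H) :
    ∫⁻ x, H x ∂Measure.pi ν = ∫⁻ x, ∫⁻ a, H (Function.update x k a) ∂ν k ∂Measure.pi ν := by
  conv_lhs => rw [← (measurePreserving_update ν k).map_eq]
  rw [lintegral_map hH (measurable_update_pair k),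
    lintegral_prod (fun p : (∀ j, Λ j) × Λ k => H (Function.update p.1 k p.2))
      (hH.comp (measurable_update_pair k)).aemeasurable]

lemma integral_pi_update (k : Fin N) {H : (∀ j, Λ j) → ℝ} (hH : Measurable H)
    (hK : ∀ x, |H x| ≤ K) :
    ∫ x, H x ∂Measure.pi ν = ∫ x, ∫ a, H (Function.update x k a) ∂ν k ∂Measure.pi ν := by
  conv_lhs => rw [← (measurePreserving_update ν k).map_eq]
  rw [integral_map (measurable_update_pair k).aemeasurable hH.aestronglyMeasurable,
    integral_prod (fun p : (∀ j, Λ j) × Λ k => H (Function.update p.1 k p.2))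
      (integrable_of_abs_le (hH.comp (measurable_update_pair k)) fun _ => hK _)]

/-- The tower property for a random set of coordinates which is determined by their values. -/
lemma integral_condMean_random (hF : Measurable F) (hK : ∀ x, |F x| ≤ K)
    (S : (∀ k, Λ k) → Finset (Fin N)) (hS : ∀ s, MeasurableSet {x | S x = s})
    (hadapt : ∀ x y, (∀ j ∈ S x, x j = y j) → S x = S y) :
    ∫ x, condMean ν F (S x) x ∂Measure.pi ν = ∫ x, F x ∂Measure.pi ν := by
  classical
  have hsum : ∀ G : Finset (Fin N) → (∀ k, Λ k) → ℝ, ∀ x,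
      G (S x) x = ∑ s, {x | S x = s}.indicator (G s) x := by
    intro G x
    rw [Finset.sum_eq_single (S x)]
    · simp
    · intro s _ hs; simp [Ne.symm hs]
    · simp
  have hind : ∀ {G : (∀ k, Λ k) → ℝ} (s : Finset (Fin N)), (∀ x, |G x| ≤ K) →
      ∀ x, |{x | S x = s}.indicator G x| ≤ K := by
    intro G s hG x
    by_cases h : S x = s
    · simpa [h] using hG x
    · simpa [h] using (abs_nonneg _).trans (hG x)
  rw [integral_congr_ae (.of_forall fun x => hsum (fun s => condMean ν F s) x),
    integral_congr_ae (μ := Measure.pi ν) (.of_forall fun x => hsum (fun _ => F) x),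
    integral_finsetSum _ fun s _ => integrable_of_abs_le
      ((measurable_condMean ν hF s).indicator (hS s)) (hind s (abs_condMean_le ν hK s)),
    integral_finsetSum _ fun s _ => integrable_of_abs_le (hF.indicator (hS s)) (hind s hK)]
  refine Finset.sum_congr rfl fun s _ => ?_
  -- By adaptedness the event `S x = s` depends on the coordinates in `s` only, so it survives
  -- resampling of all the others.
  have hkey : ∀ x y : ∀ k, Λ k, S (s.piecewise x y) = s ↔ S x = s := by
    intro x y
    constructor
    · intro h
      rw [← hadapt (s.piecewise x y) x fun j hj => ?_, h]
      rw [h] at hj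
      simp [hj]
    · intro h
      rw [← hadapt x (s.piecewise x y) fun j hj => ?_, h]
      rw [h] at hj
      simp [hj]
  have hm : Measurable ({x | S x = s}.indicator F) := hF.indicator (hS s)
  conv_rhs => rw [← (measurePreserving_piecewise ν s).map_eq]
  rw [integral_map (measurable_piecewise_pair s).aemeasurable hm.aestronglyMeasurable,
    integral_prod (fun p : (∀ j, Λ j) × (∀ j, Λ j) =>
      {x | S x = s}.indicator F (s.piecewise p.1 p.2))
      (integrable_of_abs_le (hm.comp (measurable_piecewise_pair s))
      fun _ => hind s hK _)]
  congr 1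
  ext x
  by_cases h : S x = s
  · simp [Set.indicator, h, hkey, condMean]
  · simp [Set.indicator, h, hkey]

end ProductMeasure

/-! ### Combinatorics of query strategies -/

namespace QueryStrategy

variable {N : ℕ} {Λ : Fin N → Type*} [∀ k, MeasurableSpace (Λ k)] (σ τ : QueryStrategy Λ)

/-- The set of indices exposed in the first `i` steps. -/
def exposed (i : ℕ) (x : ∀ k, Λ k) : Finset (Fin N) :=
  (Finset.range i).image fun j => σ.query j x

lemma mem_exposed {i : ℕ} {x : ∀ k, Λ k} {k : Fin N} :
    k ∈ σ.exposed i x ↔ ∃ j < i, σ.query j x = k := by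
  simp [exposed]

lemma query_mem_exposed {i j : ℕ} (h : j < i) (x : ∀ k, Λ k) :
    σ.query j x ∈ σ.exposed i x :=
  σ.mem_exposed.2 ⟨j, h, rfl⟩

lemma exposed_zero (x : ∀ k, Λ k) : σ.exposed 0 x = ∅ := rfl

lemma exposed_succ (i : ℕ) (x : ∀ k, Λ k) :
    σ.exposed (i + 1) x = insert (σ.query i x) (σ.exposed i x) := by
  simp [exposed, Finset.range_add_one]

lemma exposed_mono {i j : ℕ} (h : i ≤ j) (x : ∀ k, Λ k) : σ.exposed i x ⊆ σ.exposed j x :=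
  Finset.image_subset_image (Finset.range_mono h)

lemma mem_queried {x : ∀ k, Λ k} {k : Fin N} :
    k ∈ σ.queried x ↔ ∃ i, σ.query i x = k := by
  simp [queried]

lemma exposed_subset_queried (i : ℕ) (x : ∀ k, Λ k) : σ.exposed i x ⊆ σ.queried x := by
  intro k hk
  obtain ⟨j, -, rfl⟩ := σ.mem_exposed.1 hk
  exact σ.mem_queried.2 ⟨j, rfl⟩

lemma queried_nonempty (x : ∀ k, Λ k) : (σ.queried x).Nonempty :=
  ⟨σ.query 0 x, σ.mem_queried.2 ⟨0, rfl⟩⟩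

variable {σ} in
lemma query_congr {i : ℕ} {x y : ∀ k, Λ k} (h : ∀ j ∈ σ.exposed i x, x j = y j) {m : ℕ}
    (hm : m ≤ i) : σ.query m x = σ.query m y :=
  σ.adapted m x y fun _ hj => h _ (σ.query_mem_exposed (hj.trans_le hm) x)

variable {σ} in
-- The range reaches `i + 1`: the values exposed before step `i` already fix which index is asked in
-- step `i`.
lemma exposed_congr {i : ℕ} {x y : ∀ k, Λ k} (h : ∀ j ∈ σ.exposed i x, x j = y j) {m : ℕ}
    (hm : m ≤ i + 1) : σ.exposed m x = σ.exposed m y := by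
  refine Finset.image_congr fun j hj => query_congr h ?_
  have := Finset.mem_range.1 hj
  omega

/-- A repeated index excludes the fresh alternative, so the strategy has stopped and keeps repeating
it. -/
lemma query_mem_exposed_succ_of_mem {i : ℕ} {x : ∀ k, Λ k} (h : σ.query i x ∈ σ.exposed i x) :
    σ.query (i + 1) x ∈ σ.exposed (i + 1) x := by
  rcases i with _ | i
  · simp [exposed_zero] at h
  rcases σ.fresh_or_stopped i x with hf | hs
  · obtain ⟨j, hj, hq⟩ := σ.mem_exposed.1 h
    exact absurd hq.symm (hf j (by omega))
  · exact σ.mem_exposed.2 ⟨i, by omega, (hs (i + 2) (by omega)).symm⟩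

/-- A repetition would persist, so a fresh index in step `i` means that all earlier steps were fresh
too. -/
lemma card_exposed_succ {i : ℕ} {x : ∀ k, Λ k} (h : σ.query i x ∉ σ.exposed i x) :
    (σ.exposed (i + 1) x).card = i + 1 := by
  induction i with
  | zero => simp [exposed_succ, exposed_zero]
  | succ i ih =>
    rw [exposed_succ, Finset.card_insert_of_notMem h,
      ih fun h' => h (σ.query_mem_exposed_succ_of_mem h')]

/-- Pigeonhole: an index first asked in a step `i ≥ N` would be fresh and give `i + 1 > N` distinct
indices. -/
lemma queried_subset_exposed (x : ∀ k, Λ k) : σ.queried x ⊆ σ.exposed N x := by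
  intro k hk
  obtain ⟨i, rfl⟩ := σ.mem_queried.1 hk
  induction i using Nat.strong_induction_on with
  | _ i ih =>
    by_contra hi
    have hsub : σ.exposed i x ⊆ σ.exposed N x := by
      intro k hk
      obtain ⟨j, hj, rfl⟩ := σ.mem_exposed.1 hk
      exact ih j hj (σ.mem_queried.2 ⟨j, rfl⟩)
    have hc := σ.card_exposed_succ fun h => hi (hsub h)
    have hN : N ≤ i := by
      by_contra h
      exact hi (σ.query_mem_exposed (by omega) x)
    have := Finset.card_le_univ (σ.exposed (i + 1) x)
    rw [hc, Fintype.card_fin] at this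
    omega

lemma measurable_exposed (i : ℕ) : Measurable (σ.exposed i) := by
  refine measurable_finset_iff.2 fun k => ?_
  have : (fun x => k ∈ σ.exposed i x) = fun x => ∃ j, j < i ∧ σ.query j x = k := by
    ext x; exact σ.mem_exposed
  rw [this]
  refine Measurable.exists fun j => (measurable_const (a := j < i)).and ?_
  exact measurableSet_setOfPred.1 (σ.measurable_query j (measurableSet_singleton k))

lemma measurable_queried : Measurable σ.queried := by
  refine measurable_finset_iff.2 fun k => ?_
  have : (fun x => k ∈ σ.queried x) = fun x => ∃ j, σ.query j x = k := by
    ext x; exact σ.mem_queried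
  rw [this]
  exact Measurable.exists fun j =>
    measurableSet_setOfPred.1 (σ.measurable_query j (measurableSet_singleton k))

lemma sum_queried_le_maxSum (a : Fin N → ℝ) (x : ∀ k, Λ k) :
    ∑ k ∈ σ.queried x, a k ≤ σ.maxSum a :=
  le_ciSup (f := fun Q : σ.querySets => ∑ k ∈ (Q : Finset (Fin N)), a k)
    (Set.finite_range _).bddAbove ⟨_, Set.mem_range_self x⟩

lemma maxSum_nonneg {a : Fin N → ℝ} (ha : ∀ k, 0 ≤ a k) : 0 ≤ σ.maxSum a :=
  Real.iSup_nonneg fun _ => Finset.sum_nonneg fun k _ => ha k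

lemma le_maxMax (a : Fin N → ℝ) {x : ∀ k, Λ k} {k : Fin N} (hk : k ∈ σ.queried x) :
    a k ≤ σ.maxMax a := by
  have h1 := le_ciSup (f := fun j : σ.queried x => a j) (Set.finite_range _).bddAbove ⟨k, hk⟩
  exact h1.trans (le_ciSup (f := fun Q : σ.querySets => ⨆ k : (Q : Finset (Fin N)), a k)
    (Set.finite_range _).bddAbove ⟨_, Set.mem_range_self x⟩)

lemma maxMax_nonneg {a : Fin N → ℝ} (ha : ∀ k, 0 ≤ a k) : 0 ≤ σ.maxMax a :=
  Real.iSup_nonneg fun _ => Real.iSup_nonneg fun k => ha k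

/-- All that `σ` exposes is eventually exposed by `τ`, and the indices exposed by `τ` up to a
given step determine which of them belong to the query set of `σ`. -/
structure Refines : Prop where
  subset : ∀ x, σ.queried x ⊆ τ.exposed N x
  inter_congr : ∀ i x y, (∀ j ∈ τ.exposed i x, x j = y j) → τ.query i x ∉ τ.exposed i x →
    τ.exposed (i + 1) x ∩ σ.queried x = τ.exposed (i + 1) x ∩ σ.queried y

lemma refines_self : Refines σ σ where
  subset := σ.queried_subset_exposed
  inter_congr i x y h _ := by
    rw [Finset.inter_eq_left.2 (σ.exposed_subset_queried _ _), exposed_congr h le_rfl,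
      Finset.inter_eq_left.2 (σ.exposed_subset_queried _ _)]

/-- The strategy which exposes all variables in their natural order. -/
def natural (hN : 0 < N) : QueryStrategy Λ where
  query i _ := ⟨min i (N - 1), by omega⟩
  measurable_query _ := measurable_const
  adapted _ _ _ _ := rfl
  fresh_or_stopped i x := by
    by_cases h : i < N - 1
    · refine .inl fun j hj => ?_
      simp only [ne_eq, Fin.mk.injEq]
      omega
    · refine .inr fun m hm => ?_
      simp only [Fin.mk.injEq]
      omega

lemma mem_natural_exposed (hN : 0 < N) {i : ℕ} {x : ∀ k, Λ k} {k : Fin N} :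
    k ∈ (natural hN).exposed i x ↔ (k : ℕ) < i := by
  simp only [mem_exposed, natural, Fin.ext_iff]
  constructor
  · rintro ⟨j, hj, h⟩; omega
  · intro h; exact ⟨k, h, by omega⟩

lemma lt_of_natural_query_notMem (hN : 0 < N) {i : ℕ} {x : ∀ k, Λ k}
    (h : (natural hN).query i x ∉ (natural hN).exposed i x) : i < N := by
  rw [mem_natural_exposed] at h
  simp only [natural] at h
  omega

variable {σ} in
lemma IsMonotone.query_le (hσ : σ.IsMonotone) (x : ∀ k, Λ k) {i j : ℕ} (h : i ≤ j) :
    σ.query i x ≤ σ.query j x :=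
  monotone_nat_of_le_succ (f := fun i => σ.query i x) (fun i => hσ i x) h

variable {σ} in
-- All indices asked before the first query of `k` are smaller than `k`, where `x` and `y` agree. So
-- the strategy follows the same path on `y` until it asks `k`.
lemma IsMonotone.mem_queried_congr (hσ : σ.IsMonotone) {i : ℕ} {x y : ∀ k, Λ k}
    (h : ∀ j : Fin N, (j : ℕ) < i → x j = y j) {k : Fin N} (hk : (k : ℕ) ≤ i)
    (hq : k ∈ σ.queried x) : k ∈ σ.queried y := by
  classical
  have hex := σ.mem_queried.1 hq
  refine σ.mem_queried.2 ⟨Nat.find hex, ?_⟩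
  rw [← σ.adapted _ x y fun l hl => h _ ?_]
  · exact Nat.find_spec hex
  · have h1 : σ.query l x ≤ k := (hσ.query_le x hl.le).trans_eq (Nat.find_spec hex)
    have h2 : σ.query l x ≠ k := Nat.find_min hex hl
    exact (Fin.lt_def.1 (lt_of_le_of_ne h1 h2)).trans_le hk

variable {σ} in
lemma IsMonotone.refines_natural (hN : 0 < N) (hσ : σ.IsMonotone) :
    Refines σ (natural hN) where
  subset x k _ := (mem_natural_exposed hN).2 k.2
  inter_congr i x y h _ := by
    have h' : ∀ j : Fin N, (j : ℕ) < i → x j = y j := fun j hj =>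
      h j ((mem_natural_exposed hN).2 hj)
    ext k
    simp only [Finset.mem_inter, mem_natural_exposed]
    refine and_congr_right fun hk => ⟨hσ.mem_queried_congr h' (by omega), ?_⟩
    exact hσ.mem_queried_congr (fun j hj => (h' j hj).symm) (by omega)

end QueryStrategy

/-! ### The killed exponential supermartingale -/

section Core

variable {N : ℕ} {Λ : Fin N → Type*} [∀ k, MeasurableSpace (Λ k)]

lemma measurable_apply_finset {α β : Type*} [MeasurableSpace α] [MeasurableSpace β]
    {S : α → Finset (Fin N)} (hS : Measurable S) {F : Finset (Fin N) → α → β}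
    (hF : ∀ s, Measurable (F s)) : Measurable fun x => F (S x) x := by
  have h : Measurable fun p : Finset (Fin N) × α => F p.1 p.2 :=
    measurable_from_prod_countable_right hF
  exact h.comp (hS.prodMk measurable_id)

variable (ν : ∀ k, Measure (Λ k)) {σ τ : QueryStrategy Λ} {f : (∀ k, Λ k) → ℝ}

/-- If `σ` does not query the index exposed next by `τ`, then `f` does not depend on it. -/
lemma fibreMean_eq_condMean_of_notMem (hR : QueryStrategy.Refines σ τ) (hdet : σ.Determines f)
    {i : ℕ} {x : ∀ k, Λ k} (hk : τ.query i x ∉ τ.exposed i x)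
    (hq : τ.query i x ∉ σ.queried x) (a : Λ (τ.query i x)) :
    fibreMean ν f (τ.exposed i x) x (τ.query i x) a = condMean ν f (τ.exposed i x) x := by
  unfold fibreMean condMean
  congr 1
  ext y
  symm
  refine hdet _ _ fun j hj => ?_
  have hc := hR.inter_congr i x ((τ.exposed i x).piecewise x y)
    (fun j hj => by simp [hj]) hk
  have hne : j ≠ τ.query i x := by
    rintro rfl
    have : τ.query i x ∈ τ.exposed (i + 1) x ∩ σ.queried x := by
      rw [hc]
      exact Finset.mem_inter.2 ⟨τ.query_mem_exposed (Nat.lt_succ_self i) x, hj⟩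
    exact hq (Finset.mem_inter.1 this).2
  rw [Function.update_of_ne hne]

variable [∀ k, IsProbabilityMeasure (ν k)]

/-- The exponential supermartingale, killed as soon as the exposure leaves the sets `H`. -/
noncomputable def expWeight (σ τ : QueryStrategy Λ) (f : (∀ k, Λ k) → ℝ) (H : ℕ → Set (∀ k, Λ k))
    (v : Fin N → ℝ) (lam : ℝ) (i : ℕ) : (∀ k, Λ k) → ENNReal :=
  {x | ∀ j < i, x ∈ H j}.indicator fun x =>
    ENNReal.ofReal (Real.exp (lam * condMean ν f (τ.exposed i x) x -
      ∑ k ∈ τ.exposed i x ∩ σ.queried x, v k))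

variable {ν} {H : ℕ → Set (∀ k, Λ k)} {v : Fin N → ℝ} {lam K : ℝ}

lemma measurable_expWeight (hf : Measurable f) (hH : ∀ i, MeasurableSet (H i)) (i : ℕ) :
    Measurable (expWeight ν σ τ f H v lam i) := by
  refine Measurable.indicator ?_ ?_
  · refine ENNReal.measurable_ofReal.comp (Real.measurable_exp.comp (Measurable.sub ?_ ?_))
    · exact (measurable_apply_finset (τ.measurable_exposed i)
        fun s => measurable_condMean ν hf s).const_mul lam
    · exact measurable_apply_finset (τ.measurable_exposed i)
        (F := fun s x => ∑ k ∈ s ∩ σ.queried x, v k) fun s =>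
          measurable_apply_finset σ.measurable_queried
            (F := fun q _ => ∑ k ∈ s ∩ q, v k) fun q => measurable_const
  · have : {x : ∀ k, Λ k | ∀ j < i, x ∈ H j} = ⋂ j, ⋂ _ : j < i, H j := by ext; simp
    rw [this]
    exact .iInter fun j => .iInter fun _ => hH j

/-- If `σ` queries `k`, the compensator grows by `v k`, which pays for the moment generating
function of the increment. Otherwise neither the compensator nor the conditional mean changes. -/
lemma lintegral_expWeight_fibre_le (hR : QueryStrategy.Refines σ τ) (hf : Measurable f)
    (hK : ∀ x, |f x| ≤ K) (hdet : σ.Determines f)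
    (hadapt : ∀ i x y, (∀ j ∈ τ.exposed i x, x j = y j) → (x ∈ H i ↔ y ∈ H i))
    {i : ℕ} {x : ∀ k, Λ k} {k : Fin N} (hk : τ.query i x = k) (hfresh : k ∉ τ.exposed i x)
    (hstep : x ∈ H i → k ∈ σ.queried x →
      ∫ a, Real.exp (lam * (fibreMean ν f (τ.exposed i x) x k a -
        condMean ν f (τ.exposed i x) x)) ∂ν k ≤ Real.exp (v k)) :
    ∫⁻ a, expWeight ν σ τ f H v lam (i + 1) (Function.update x k a) ∂ν k ≤
      expWeight ν σ τ f H v lam i x := by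
  have hagree : ∀ a, ∀ j ∈ τ.exposed i x, x j = Function.update x k a j := fun a j hj => by
    rw [Function.update_of_ne (ne_of_mem_of_not_mem hj hfresh)]
  -- If the process is killed at `x`, adaptedness of `H` kills it on the whole fibre, because
  -- coordinate `k` is not yet exposed.
  by_cases hx : ∀ j < i + 1, x ∈ H j
  swap
  · push Not at hx
    obtain ⟨j, hj, hxj⟩ := hx
    have : ∀ a, expWeight ν σ τ f H v lam (i + 1) (Function.update x k a) = 0 := fun a => by
      refine Set.indicator_of_notMem (fun h => hxj ?_) _
      exact (hadapt j x _ fun l hl =>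
        hagree a l (τ.exposed_mono (Nat.lt_succ_iff.1 hj) x hl)).2 (h j hj)
    simp [this]
  have hexp : ∀ a, τ.exposed (i + 1) (Function.update x k a) = insert k (τ.exposed i x) :=
    fun a => by
      rw [← QueryStrategy.exposed_congr (hagree a) le_rfl, QueryStrategy.exposed_succ, hk]
  -- Predictability of the compensator: the value revealed at `k` does not affect which exposed
  -- indices count.
  have hint : ∀ a, insert k (τ.exposed i x) ∩ σ.queried (Function.update x k a) =
      insert k (τ.exposed i x) ∩ σ.queried x := fun a => by
    have := hR.inter_congr i x _ (hagree a) (hk ▸ hfresh)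
    rw [QueryStrategy.exposed_succ, hk] at this
    exact this.symm
  set S := τ.exposed i x with hS
  set g := fibreMean ν f S x k with hg
  set m := condMean ν f S x with hm
  have hZ : ∀ a, expWeight ν σ τ f H v lam (i + 1) (Function.update x k a) =
      ENNReal.ofReal (Real.exp (lam * g a - ∑ j ∈ insert k S ∩ σ.queried x, v j)) := fun a => by
    unfold expWeight
    rw [Set.indicator_of_mem, hexp, hint, condMean_insert ν hfresh]
    intro j hj
    exact (hadapt j x _ fun l hl =>
        hagree a l (τ.exposed_mono (Nat.lt_succ_iff.1 hj) x hl)).1 (hx j hj)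
  have hZx : expWeight ν σ τ f H v lam i x =
      ENNReal.ofReal (Real.exp (lam * m - ∑ j ∈ S ∩ σ.queried x, v j)) := by
    unfold expWeight
    rw [Set.indicator_of_mem]
    exact fun j hj => hx j (by omega)
  have hgm : Measurable g := measurable_fibreMean ν hf S x k
  simp_rw [hZ]
  rw [hZx]
  by_cases hq : k ∈ σ.queried x
  · have hsum : ∑ j ∈ insert k S ∩ σ.queried x, v j = v k + ∑ j ∈ S ∩ σ.queried x, v j := by
      rw [Finset.insert_inter_of_mem hq, Finset.sum_insert fun h => hfresh (Finset.mem_inter.1 h).1]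
    set w := ∑ j ∈ S ∩ σ.queried x, v j
    have hsplit : ∀ a, Real.exp (lam * g a - (v k + w)) =
        Real.exp (lam * m - w - v k) * Real.exp (lam * (g a - m)) := fun a => by
      rw [← Real.exp_add]; ring_nf
    simp_rw [hsum, hsplit]
    rw [← ofReal_integral_eq_lintegral_ofReal, integral_const_mul]
    · refine ENNReal.ofReal_le_ofReal ?_
      calc _ ≤ Real.exp (lam * m - w - v k) * Real.exp (v k) :=
            mul_le_mul_of_nonneg_left (hstep (hx i (Nat.lt_succ_self i)) hq) (Real.exp_pos _).le
        _ = _ := by rw [← Real.exp_add]; ring_nf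
    · refine Integrable.const_mul (integrable_of_abs_le (K := Real.exp (|lam| * (K + K)))
        (Real.measurable_exp.comp ((hgm.sub_const m).const_mul lam)) fun a => ?_) _
      rw [Function.comp_apply, abs_of_pos (Real.exp_pos _), Real.exp_le_exp]
      refine (le_abs_self _).trans ?_
      rw [abs_mul]
      refine mul_le_mul_of_nonneg_left ((abs_sub _ _).trans ?_) (abs_nonneg _)
      exact add_le_add (abs_fibreMean_le ν hK S x k a) (abs_condMean_le ν hK S x)
    · exact .of_forall fun a => by positivity
  · have hga : ∀ a, g a = m := fun a => by
      subst hk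
      exact fibreMean_eq_condMean_of_notMem ν hR hdet hfresh hq a
    rw [Finset.insert_inter_of_notMem hq]
    simp [hga]

/-- The next index is random, so the space is split into the set `A` where nothing new is exposed
and the sets `D k` where `k` is fresh and next. Membership in `D k` does not depend on coordinate
`k`, so each `D k` can be treated by resampling that coordinate. -/
lemma lintegral_expWeight_succ_le (hR : QueryStrategy.Refines σ τ) (hf : Measurable f)
    (hK : ∀ x, |f x| ≤ K) (hdet : σ.Determines f) (hH : ∀ i, MeasurableSet (H i))
    (hadapt : ∀ i x y, (∀ j ∈ τ.exposed i x, x j = y j) → (x ∈ H i ↔ y ∈ H i)) (i : ℕ)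
    (hstep : ∀ᵐ x ∂Measure.pi ν, x ∈ H i → τ.query i x ∉ τ.exposed i x →
      τ.query i x ∈ σ.queried x →
      ∫ a, Real.exp (lam * (fibreMean ν f (τ.exposed i x) x (τ.query i x) a -
        condMean ν f (τ.exposed i x) x)) ∂ν (τ.query i x) ≤ Real.exp (v (τ.query i x))) :
    ∫⁻ x, expWeight ν σ τ f H v lam (i + 1) x ∂Measure.pi ν ≤
      ∫⁻ x, expWeight ν σ τ f H v lam i x ∂Measure.pi ν := by
  classical
  let A : Set (∀ k, Λ k) := {x | τ.query i x ∈ τ.exposed i x}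
  let D : Fin N → Set (∀ k, Λ k) := fun k => {x | τ.query i x = k ∧ k ∉ τ.exposed i x}
  have hT : ∀ k, MeasurableSet {x | τ.query i x = k} := fun k =>
    τ.measurable_query i (measurableSet_singleton k)
  have hE : ∀ k, MeasurableSet {x | k ∈ τ.exposed i x} := fun k =>
    τ.measurable_exposed i (measurableSet_mem_finset k)
  have hD : ∀ k, MeasurableSet (D k) := fun k => (hT k).inter (hE k).compl
  have hA : MeasurableSet A := by
    have : A = ⋃ k, {x | τ.query i x = k} ∩ {x | k ∈ τ.exposed i x} := by ext; simp [A]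
    rw [this]
    exact .iUnion fun k => (hT k).inter (hE k)
  have hsplit : ∀ (G : (∀ k, Λ k) → ENNReal) x,
      G x = A.indicator G x + ∑ k, (D k).indicator G x := by
    intro G x
    by_cases hx : x ∈ A
    · rw [Set.indicator_of_mem hx, Finset.sum_eq_zero, add_zero]
      intro k _
      refine Set.indicator_of_notMem (fun h => h.2 ?_) _
      rw [← h.1]; exact hx
    · rw [Set.indicator_of_notMem hx, Finset.sum_eq_single (τ.query i x), zero_add,
        Set.indicator_of_mem (show x ∈ D (τ.query i x) from ⟨rfl, hx⟩)]
      · intro k _ hk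
        exact Set.indicator_of_notMem (fun h => hk h.1.symm) _
      · simp
  have hm := fun i => measurable_expWeight (ν := ν) (σ := σ) (τ := τ) (v := v) (lam := lam) hf hH i
  have hint : ∀ j, ∫⁻ x, expWeight ν σ τ f H v lam j x ∂Measure.pi ν =
      ∫⁻ x, A.indicator (expWeight ν σ τ f H v lam j) x ∂Measure.pi ν +
      ∑ k, ∫⁻ x, (D k).indicator (expWeight ν σ τ f H v lam j) x ∂Measure.pi ν := fun j => by
    rw [lintegral_congr (hsplit _), lintegral_add_left ((hm j).indicator hA),
      lintegral_finsetSum _ fun k _ => (hm j).indicator (hD k)]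
  rw [hint, hint]
  refine add_le_add (lintegral_mono fun x => ?_) (Finset.sum_le_sum fun k _ => ?_)
  · by_cases hx : x ∈ A
    · rw [Set.indicator_of_mem hx, Set.indicator_of_mem hx]
      unfold expWeight
      have hexp : τ.exposed (i + 1) x = τ.exposed i x := by
        rw [QueryStrategy.exposed_succ, Finset.insert_eq_of_mem hx]
      by_cases h : x ∈ {x : ∀ k, Λ k | ∀ j < i + 1, x ∈ H j}
      · have h' : x ∈ {x : ∀ k, Λ k | ∀ j < i, x ∈ H j} := fun j hj => h j (by omega)
        rw [Set.indicator_of_mem h, Set.indicator_of_mem h', hexp]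
      · rw [Set.indicator_of_notMem h]
        exact zero_le
    · simp [hx]
  · rw [lintegral_pi_update ν k ((hm (i + 1)).indicator (hD k))]
    refine lintegral_mono_ae (hstep.mono fun x hx => ?_)
    by_cases hxD : x ∈ D k
    · rw [Set.indicator_of_mem hxD]
      refine (lintegral_mono fun a => Set.indicator_le_self _ _ _).trans ?_
      refine lintegral_expWeight_fibre_le hR hf hK hdet hadapt hxD.1 hxD.2 fun h1 h2 => ?_
      obtain ⟨rfl, h4⟩ := hxD
      exact hx h1 h4 h2
    · have : ∀ a, Function.update x k a ∉ D k := fun a h => by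
        refine hxD ?_
        have hag : ∀ j ∈ τ.exposed i (Function.update x k a), Function.update x k a j = x j :=
          fun j hj => Function.update_of_ne (ne_of_mem_of_not_mem hj h.2) _ _
        exact ⟨(QueryStrategy.query_congr hag le_rfl).symm.trans h.1,
          by rw [← QueryStrategy.exposed_congr hag (Nat.le_succ i)]; exact h.2⟩
      simp [this]

/-- The exponential tail bound for a dynamically exposed martingale. -/
theorem exposure_tail_le (hR : QueryStrategy.Refines σ τ) (hf : Measurable f)
    (hK : ∀ x, |f x| ≤ K) (hdet : σ.Determines f) (hH : ∀ i, MeasurableSet (H i))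
    (hadapt : ∀ i x y, (∀ j ∈ τ.exposed i x, x j = y j) → (x ∈ H i ↔ y ∈ H i))
    (hlam : 0 ≤ lam) {t W : ℝ} (hW : ∀ x, ∑ k ∈ σ.queried x, v k ≤ W)
    (hstep : ∀ i, ∀ᵐ x ∂Measure.pi ν, x ∈ H i → τ.query i x ∉ τ.exposed i x →
      τ.query i x ∈ σ.queried x →
      ∫ a, Real.exp (lam * (fibreMean ν f (τ.exposed i x) x (τ.query i x) a -
        condMean ν f (τ.exposed i x) x)) ∂ν (τ.query i x) ≤ Real.exp (v (τ.query i x))) :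
    (Measure.pi ν).real {x | ∫ y, f y ∂Measure.pi ν + t ≤ f x ∧ ∀ i, x ∈ H i} ≤
      Real.exp (-lam * t + W) := by
  have hmono : ∀ i, ∫⁻ x, expWeight ν σ τ f H v lam i x ∂Measure.pi ν ≤
      ENNReal.ofReal (Real.exp (lam * ∫ y, f y ∂Measure.pi ν)) := by
    intro i
    induction i with
    | zero => simp [expWeight, QueryStrategy.exposed_zero, condMean_empty]
    | succ i ih =>
      exact (lintegral_expWeight_succ_le hR hf hK hdet hH hadapt i (hstep i)).trans ih
  set m := ∫ y, f y ∂Measure.pi ν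
  set E := {x | m + t ≤ f x ∧ ∀ i, x ∈ H i} with hE
  have hle : ENNReal.ofReal (Real.exp (lam * (m + t) - W)) * Measure.pi ν E ≤
      ENNReal.ofReal (Real.exp (lam * m)) := by
    refine le_trans ?_ (hmono N)
    refine le_trans ?_ (mul_meas_ge_le_lintegral (measurable_expWeight hf hH N)
      (ENNReal.ofReal (Real.exp (lam * (m + t) - W))))
    refine mul_le_mul_right (measure_mono fun x hx => ?_) _
    -- After `N` steps all queries of `σ` are exposed, so the martingale has reached `f x`.
    have hfx : condMean ν f (τ.exposed N x) x = f x := by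
      have : ∀ y, f ((τ.exposed N x).piecewise x y) = f x := fun y =>
        (hdet _ _ fun k hk => by simp [hR.subset x hk]).symm
      simp [condMean, this]
    change _ ≤ expWeight ν σ τ f H v lam N x
    unfold expWeight
    rw [Set.indicator_of_mem (show x ∈ {x : ∀ k, Λ k | ∀ j < N, x ∈ H j} from fun j _ => hx.2 j), hfx,
      Finset.inter_eq_right.2 (hR.subset x)]
    refine ENNReal.ofReal_le_ofReal (Real.exp_le_exp.2 (sub_le_sub ?_ (hW x)))
    exact mul_le_mul_of_nonneg_left hx.1 hlam
  rw [Measure.real, ← ENNReal.toReal_ofReal (Real.exp_pos (-lam * t + W)).le]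
  refine ENNReal.toReal_mono ENNReal.ofReal_ne_top ?_
  have hpos := Real.exp_pos (lam * (m + t) - W)
  rw [mul_comm, ← ENNReal.le_div_iff_mul_le (.inl (by simpa using hpos)) (.inl (by simp)),
    ← ENNReal.ofReal_div_of_pos hpos, ← Real.exp_sub] at hle
  refine hle.trans_eq ?_
  congr 2
  ring

end Core

/-! ### Moment generating functions of one increment -/

section OneVariable

lemma exp_le_quadratic_of_nonpos {x : ℝ} (hx : x ≤ 0) : Real.exp x ≤ 1 + x + x ^ 2 / 2 := by
  have hd : ∀ y : ℝ, HasDerivAt (fun y : ℝ => 1 + y + y ^ 2 / 2 - Real.exp y)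
      (1 + y - Real.exp y) y := fun y => by
    have h := (((hasDerivAt_id y).const_add 1).add ((hasDerivAt_pow 2 y).div_const 2)).sub
      (Real.hasDerivAt_exp y)
    refine (h.congr_deriv ?_)
    norm_num
  have hanti : Antitone fun y : ℝ => 1 + y + y ^ 2 / 2 - Real.exp y := by
    refine antitone_of_deriv_nonpos (fun y => (hd y).differentiableAt) fun y => ?_
    rw [(hd y).deriv]
    linarith [Real.add_one_le_exp y]
  have := hanti hx
  simp at this
  linarith

/-- A division-free form of the monotonicity of `(exp x - 1 - x) / x ^ 2` on the positive half-line.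
After differentiation it is convexity of `exp` between `0` and `y`. -/
lemma exp_mul_sub_le {s : ℝ} (hs : 0 ≤ s) (hs1 : s ≤ 1) {b : ℝ} (hb : 0 ≤ b) :
    Real.exp (s * b) - 1 - s * b ≤ s ^ 2 * (Real.exp b - 1 - b) := by
  have hd : ∀ y : ℝ, HasDerivAt
      (fun y : ℝ => s ^ 2 * (Real.exp y - 1 - y) - (Real.exp (s * y) - 1 - s * y))
      (s ^ 2 * (Real.exp y - 1) - (Real.exp (s * y) * s - s)) y := fun y => by
    have h1 := (((Real.hasDerivAt_exp y).sub_const 1).sub (hasDerivAt_id y)).const_mul (s ^ 2)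
    have h2 : HasDerivAt (fun y : ℝ => s * y) s y := by
      simpa using (hasDerivAt_id y).const_mul s
    exact h1.sub ((h2.exp.sub_const 1).sub h2)
  have hmono : Monotone
      fun y : ℝ => s ^ 2 * (Real.exp y - 1 - y) - (Real.exp (s * y) - 1 - s * y) := by
    refine monotone_of_deriv_nonneg (fun y => (hd y).differentiableAt) fun y => ?_
    rw [(hd y).deriv]
    have hc := convexOn_exp.2 (Set.mem_univ y) (Set.mem_univ (0 : ℝ)) hs (sub_nonneg.2 hs1)
      (by ring)
    simp only [smul_eq_mul, mul_zero, add_zero, Real.exp_zero, mul_one] at hc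
    nlinarith [mul_le_mul_of_nonneg_left hc hs]
  have := hmono hb
  simp at this
  linarith

/-- The quotient `(exp x - 1 - x) / x ^ 2` is at most `1 / 2` for negative `x`, at least `1 / 2` at
`b`, and increasing in between. -/
lemma exp_le_bennett {x b : ℝ} (hb : 0 < b) (hx : x ≤ b) :
    Real.exp x ≤ 1 + x + x ^ 2 * ((Real.exp b - 1 - b) / b ^ 2) := by
  rcases le_total x 0 with h | h
  · have h1 := exp_le_quadratic_of_nonpos h
    have h2 : 1 / 2 ≤ (Real.exp b - 1 - b) / b ^ 2 := by
      rw [le_div_iff₀ (by positivity)]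
      linarith [Real.quadratic_le_exp_of_nonneg hb.le]
    nlinarith [mul_le_mul_of_nonneg_left h2 (sq_nonneg x)]
  · have h1 := exp_mul_sub_le (s := x / b) (by positivity) ((div_le_one hb).2 hx) hb.le
    rw [div_mul_cancel₀ _ hb.ne', div_pow, div_mul_eq_mul_div, mul_div_assoc] at h1
    linarith

variable {α : Type*} [MeasurableSpace α] {ρ : Measure α} [IsProbabilityMeasure ρ] {g : α → ℝ}

lemma hoeffding_mgf_le (hg : Measurable g) {l u : ℝ} (h : ∀ᵐ a ∂ρ, g a ∈ Set.Icc l u) (lam : ℝ) :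
    ∫ a, Real.exp (lam * (g a - ∫ b, g b ∂ρ)) ∂ρ ≤ Real.exp (lam ^ 2 * (u - l) ^ 2 / 8) := by
  refine ((hasSubgaussianMGF_of_mem_Icc hg.aemeasurable h).mgf_le lam).trans_eq ?_
  congr 1
  push_cast
  rw [Real.norm_eq_abs, div_pow, sq_abs]
  ring

/-- Integrate `exp_le_bennett`: the linear term vanishes by centring, the quadratic one is the
variance, and `1 + y ≤ exp y`. Only an upper bound on the deviation is needed. -/
lemma bennett_mgf_le (hg : Measurable g) {K : ℝ} (hK : ∀ a, |g a| ≤ K) {C w lam : ℝ} (hC : 0 < C)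
    (hlam : 0 ≤ lam) (hgC : ∀ᵐ a ∂ρ, g a - ∫ b, g b ∂ρ ≤ C)
    (hw : ∫ a, (g a - ∫ b, g b ∂ρ) ^ 2 ∂ρ ≤ w) :
    ∫ a, Real.exp (lam * (g a - ∫ b, g b ∂ρ)) ∂ρ ≤
      Real.exp (w * ((Real.exp (lam * C) - 1 - lam * C) / C ^ 2)) := by
  rcases hlam.eq_or_lt with rfl | hlam
  · simp
  set m := ∫ b, g b ∂ρ
  set κ := (Real.exp (lam * C) - 1 - lam * C) / (lam * C) ^ 2 with hκ
  have hκ0 : 0 ≤ κ := div_nonneg (by linarith [Real.add_one_le_exp (lam * C)]) (sq_nonneg _)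
  have hgi : Integrable g ρ := integrable_of_abs_le hg hK
  have hdm : Measurable fun a => g a - m := hg.sub_const m
  have hdK : ∀ a, |g a - m| ≤ K + |m| := fun a =>
    (abs_sub _ _).trans (add_le_add_left (hK a) _)
  have hi1 : Integrable (fun a => g a - m) ρ := integrable_of_abs_le hdm hdK
  have hi2 : Integrable (fun a => (g a - m) ^ 2) ρ :=
    integrable_of_abs_le (K := (K + |m|) ^ 2) (hdm.pow_const 2) fun a => by
      rw [abs_pow]; exact pow_le_pow_left₀ (abs_nonneg _) (hdK a) 2
  have hi0 : Integrable (fun a => Real.exp (lam * (g a - m))) ρ :=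
    integrable_of_abs_le (K := Real.exp (lam * (K + |m|)))
      (Real.measurable_exp.comp (hdm.const_mul lam)) fun a => by
        rw [abs_of_pos (Real.exp_pos _), Real.exp_le_exp]
        exact mul_le_mul_of_nonneg_left ((le_abs_self _).trans (hdK a)) hlam.le
  calc ∫ a, Real.exp (lam * (g a - m)) ∂ρ
      ≤ ∫ a, (1 + lam * (g a - m) + (lam ^ 2 * κ) * (g a - m) ^ 2) ∂ρ := by
        refine integral_mono_ae hi0
          (((integrable_const 1).add (hi1.const_mul lam)).add (hi2.const_mul _)) ?_
        filter_upwards [hgC] with a ha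
        have := exp_le_bennett (mul_pos hlam hC) (mul_le_mul_of_nonneg_left ha hlam.le)
        refine this.trans_eq ?_
        simp only [hκ]
        ring
    _ = 1 + lam ^ 2 * κ * ∫ a, (g a - m) ^ 2 ∂ρ := by
        rw [integral_add (f := fun a => 1 + lam * (g a - m))
            ((integrable_const 1).add (hi1.const_mul lam)) (hi2.const_mul _),
          integral_add (integrable_const 1) (hi1.const_mul lam), integral_const_mul,
          integral_const_mul, integral_sub hgi (integrable_const m)]
        simp [m]
    _ ≤ 1 + lam ^ 2 * κ * w := by gcongr
    _ ≤ Real.exp (lam ^ 2 * κ * w) := by linarith [Real.add_one_le_exp (lam ^ 2 * κ * w)]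
    _ = _ := by
        congr 1
        simp only [hκ]
        field_simp

end OneVariable

/-! ### Optimisation over the Chernoff parameter -/

section Bounds

lemma expNegDiv_nonneg (a b : ℝ) : 0 ≤ expNegDiv a b := by
  unfold expNegDiv
  split_ifs <;> positivity

lemma bennettBound_nonneg (V C t : ℝ) : 0 ≤ bennettBound V C t := by
  unfold bennettBound
  split_ifs <;> positivity

lemma expNegDiv_mul_left {r : ℝ} (hr : r ≠ 0) (a b : ℝ) :
    expNegDiv (r * a) (r * b) = expNegDiv a b := by
  unfold expNegDiv
  rw [mul_div_mul_left _ _ hr]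
  simp [hr]

/-- Let `lam → ∞`. This settles the degenerate bounds, which are read as `0` for `t > 0`. -/
lemma nonpos_of_le_exp_neg {R t : ℝ} (ht : 0 < t) (h : ∀ lam : ℝ, 0 ≤ lam → R ≤ Real.exp (-lam * t)) :
    R ≤ 0 := by
  by_contra! hR
  have h1 := h (max 0 (-Real.log (R / 2) / t)) (le_max_left _ _)
  have h2 : Real.exp (-max 0 (-Real.log (R / 2) / t) * t) ≤ R / 2 := by
    rw [← Real.le_log_iff_exp_le (by positivity)]
    have := mul_le_mul_of_nonneg_right (le_max_right 0 (-Real.log (R / 2) / t)) ht.le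
    rw [div_mul_cancel₀ _ ht.ne'] at this
    linarith
  linarith

lemma le_expNegDiv_of_chernoff {R t S : ℝ} (ht : 0 ≤ t) (hS : 0 ≤ S)
    (h : ∀ lam : ℝ, 0 ≤ lam → R ≤ Real.exp (-lam * t + lam ^ 2 * S / 8)) :
    R ≤ expNegDiv (2 * t ^ 2) S := by
  unfold expNegDiv
  split_ifs with h0 h1
  · simpa using h 0 le_rfl
  · subst h0
    have ht' : t ≠ 0 := by rintro rfl; simp at h1
    exact nonpos_of_le_exp_neg (ht.lt_of_ne' ht') (by simpa using h)
  -- The minimiser of `-lam * t + lam ^ 2 * S / 8`.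
  · refine (h (4 * t / S) (by positivity)).trans_eq ?_
    congr 1
    field_simp
    ring

/-- Solved for the logarithm, the claim is `log (1 + u) ≥ (5 * u ^ 2 + 6 * u) / (2 * (3 + u) * (1 +
u))`. Both sides vanish at `0`, and their difference has nonnegative derivative. -/
lemma le_phi {u : ℝ} (hu : 0 ≤ u) : u ^ 2 / (2 + 2 * u / 3) ≤ phi u := by
  have hd : ∀ y : ℝ, 0 ≤ y → HasDerivAt
      (fun y : ℝ => Real.log (1 + y) - (5 * y ^ 2 + 6 * y) / (2 * (3 + y) * (1 + y)))
      (1 / (1 + y) - ((10 * y + 6) * (2 * (3 + y) * (1 + y)) -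
        (5 * y ^ 2 + 6 * y) * (8 + 4 * y)) / (2 * (3 + y) * (1 + y)) ^ 2) y := fun y hy => by
    have h0 : HasDerivAt (fun y : ℝ => 1 + y) 1 y := (hasDerivAt_id y).const_add 1
    have h1 : HasDerivAt (fun y : ℝ => 5 * y ^ 2 + 6 * y) (10 * y + 6) y := by
      refine (((hasDerivAt_pow 2 y).const_mul 5).add
        ((hasDerivAt_id y).const_mul 6)).congr_deriv ?_
      norm_num; ring
    have h2 : HasDerivAt (fun y : ℝ => 2 * (3 + y) * (1 + y)) (8 + 4 * y) y := by
      refine ((((hasDerivAt_id y).const_add 3).const_mul 2).mul h0).congr_deriv ?_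
      simp; ring
    exact (h0.log (by positivity)).sub (h1.div h2 (by positivity))
  have hmono : MonotoneOn
      (fun y : ℝ => Real.log (1 + y) - (5 * y ^ 2 + 6 * y) / (2 * (3 + y) * (1 + y)))
      (Set.Ici 0) := by
    refine monotoneOn_of_deriv_nonneg (convex_Ici 0)
      (fun y hy => (hd y hy).continuousAt.continuousWithinAt)
      (fun y hy => (hd y (interior_subset hy)).differentiableAt.differentiableWithinAt)
      fun y hy => ?_
    have hy : (0 : ℝ) ≤ y := interior_subset hy
    rw [(hd y hy).deriv, sub_nonneg, div_le_div_iff₀ (by positivity) (by positivity)]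
    have : 0 ≤ y ^ 2 * (y + 1) * y := by positivity
    nlinarith [this, pow_nonneg hy 3, pow_nonneg hy 4, pow_nonneg hy 2]
  have h := hmono (Set.self_mem_Ici) hu hu
  simp only [add_zero, Real.log_one] at h
  norm_num at h
  unfold phi
  have h1 : u ^ 2 / (2 + 2 * u / 3) =
      (1 + u) * ((5 * u ^ 2 + 6 * u) / (2 * (3 + u) * (1 + u))) - u := by
    field_simp
    ring
  rw [h1]
  exact sub_le_sub_right (mul_le_mul_of_nonneg_left h (by positivity)) _

/-- The assumption is made for all positive `C' ≥ C` because `C` itself may vanish when `V = 0`; in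
that case any `C'` will do. The Bernstein bound is deduced from the Bennett bound by `le_phi`. -/
lemma le_bernstein_bennett_of_chernoff {R t V C : ℝ} (ht : 0 ≤ t) (hV : 0 ≤ V) (hC : 0 ≤ C)
    (hVC : 0 < V → 0 < C)
    (h : ∀ C' : ℝ, 0 < C' → C ≤ C' → ∀ lam : ℝ, 0 ≤ lam →
      R ≤ Real.exp (-lam * t + V * ((Real.exp (lam * C') - 1 - lam * C') / C' ^ 2))) :
    R ≤ bernsteinBound V C t ∧ R ≤ bennettBound V C t := by
  rcases hV.eq_or_lt with rfl | hV
  · have h' := h (C + 1) (by linarith) (by linarith)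
    simp only [zero_mul, add_zero] at h'
    rcases ht.eq_or_lt with rfl | ht
    · have := h' 0 le_rfl
      simp only [mul_zero, Real.exp_zero] at this
      exact ⟨by simpa [bernsteinBound, expNegDiv] using this,
        by simpa [bennettBound] using this⟩
    · have := nonpos_of_le_exp_neg ht h'
      exact ⟨this.trans (expNegDiv_nonneg _ _), this.trans (bennettBound_nonneg _ _ _)⟩
  · have hC := hVC hV
    have hu : 0 ≤ C * t / V := by positivity
    have hben : R ≤ Real.exp (-(V / C ^ 2 * phi (C * t / V))) := by
      -- The minimising parameter, characterised by `exp (lam * C) = 1 + C * t / V`.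
      refine (h C hC le_rfl (Real.log (1 + C * t / V) / C)
        (div_nonneg (Real.log_nonneg (by linarith)) hC.le)).trans_eq ?_
      rw [div_mul_cancel₀ _ hC.ne', Real.exp_log (by positivity)]
      congr 1
      unfold phi
      field_simp
      ring
    refine ⟨hben.trans ?_, by simpa [bennettBound, hV.ne'] using hben⟩
    have hden : 0 < 2 * V + 2 * C * t / 3 := by positivity
    rw [bernsteinBound, expNegDiv, if_neg hden.ne', Real.exp_le_exp, neg_le_neg_iff]
    refine le_trans (le_of_eq ?_) (mul_le_mul_of_nonneg_left (le_phi hu)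
      (show 0 ≤ V / C ^ 2 by positivity))
    field_simp

end Bounds

/-! ### Variance and range of one increment -/

section Variance

variable {α : Type*} [MeasurableSpace α] {ρ : Measure α} [IsProbabilityMeasure ρ] {g : α → ℝ}

lemma integral_sq_sub_integral_le (hg : Measurable g) {K : ℝ} (hK : ∀ a, |g a| ≤ K) (z : ℝ) :
    ∫ a, (g a - ∫ b, g b ∂ρ) ^ 2 ∂ρ ≤ ∫ a, (g a - z) ^ 2 ∂ρ := by
  have hi : Integrable g ρ := integrable_of_abs_le hg hK
  have hi2 : Integrable (fun a => g a ^ 2) ρ :=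
    integrable_of_abs_le (K := K ^ 2) (hg.pow_const 2) fun a => by
      rw [abs_pow]; exact pow_le_pow_left₀ (abs_nonneg _) (hK a) 2
  have key : ∀ w : ℝ, ∫ a, (g a - w) ^ 2 ∂ρ =
      ∫ a, g a ^ 2 ∂ρ - 2 * w * ∫ a, g a ∂ρ + w ^ 2 := fun w => by
    have : ∀ a, (g a - w) ^ 2 = g a ^ 2 - 2 * w * g a + w ^ 2 := fun a => by ring
    simp_rw [this]
    rw [integral_add (f := fun a => g a ^ 2 - 2 * w * g a) (hi2.sub (hi.const_mul _))
      (integrable_const _), integral_sub hi2 (hi.const_mul _), integral_const_mul]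
    simp
  rw [key, key]
  nlinarith [sq_nonneg (z - ∫ a, g a ∂ρ)]

variable [MeasurableSingletonClass α]

/-- The variance of a function which mostly takes one value. -/
lemma variance_le_of_atom (hg : Measurable g) {K : ℝ} (hK : ∀ a, |g a| ≤ K) {η : α} {p r : ℝ}
    (hη : 1 - p ≤ ρ.real {η}) (hr : ∀ a, |g a - g η| ≤ r) :
    ∫ a, (g a - ∫ b, g b ∂ρ) ^ 2 ∂ρ ≤ p * r ^ 2 := by
  refine (integral_sq_sub_integral_le hg hK (g η)).trans ?_
  have hbd : ∀ a, (g a - g η) ^ 2 ≤ ({η}ᶜ : Set α).indicator (fun _ => r ^ 2) a := fun a => by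
    by_cases ha : a = η
    · simp [ha]
    · rw [Set.indicator_of_mem (by simpa using ha), ← sq_abs]
      exact pow_le_pow_left₀ (abs_nonneg _) (hr a) 2
  have hi : Integrable (({η}ᶜ : Set α).indicator fun _ => r ^ 2) ρ :=
    (integrable_const _).indicator (measurableSet_singleton η).compl
  calc ∫ a, (g a - g η) ^ 2 ∂ρ ≤ ∫ a, ({η}ᶜ : Set α).indicator (fun _ => r ^ 2) a ∂ρ :=
        integral_mono_of_nonneg (.of_forall fun a => sq_nonneg _) hi (.of_forall hbd)
    _ = (1 - ρ.real {η}) * r ^ 2 := by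
        rw [integral_indicator_const _ (measurableSet_singleton η).compl,
          probReal_compl_eq_one_sub (measurableSet_singleton η), smul_eq_mul]
    _ ≤ p * r ^ 2 := mul_le_mul_of_nonneg_right (by linarith) (sq_nonneg r)

lemma exists_other_of_card_two {α : Type*} (h : Nat.card α = 2) (a : α) :
    ∃ b, b ≠ a ∧ ∀ z, z = a ∨ z = b := by
  obtain ⟨x, y, hxy, huniv⟩ := Nat.card_eq_two_iff.1 h
  have hz : ∀ z, z = x ∨ z = y := fun z => by
    have : z ∈ ({x, y} : Set α) := huniv ▸ Set.mem_univ z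
    simpa using this
  rcases hz a with rfl | rfl
  · exact ⟨y, hxy.symm, hz⟩
  · exact ⟨x, hxy, fun z => (hz z).symm⟩

/-- The variance of a function on a two-point space. -/
lemma variance_le_of_card_two (hcard : Nat.card α = 2) (one : α) {r : ℝ}
    (hr : ∀ a b, |g a - g b| ≤ r) :
    ∫ a, (g a - ∫ b, g b ∂ρ) ^ 2 ∂ρ ≤ (1 - ρ.real {one}) * ρ.real {one} * r ^ 2 := by
  obtain ⟨o, ho, hall⟩ := exists_other_of_card_two hcard one
  have hrep : ∀ h : α → ℝ, ∫ a, h a ∂ρ = h o + (h one - h o) * ρ.real {one} := fun h => by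
    have : ∀ a, h a = h o + ({one} : Set α).indicator (fun _ => h one - h o) a := fun a => by
      rcases hall a with rfl | rfl
      · simp
      · simp [ho]
    calc _ = ∫ a, (h o + ({one} : Set α).indicator (fun _ => h one - h o) a) ∂ρ :=
          integral_congr_ae (.of_forall this)
      _ = _ := by
        rw [integral_add (integrable_const _)
          ((integrable_const _).indicator (measurableSet_singleton one)),
          integral_indicator_const _ (measurableSet_singleton one)]
        simp [mul_comm]
  have hp0 : 0 ≤ ρ.real {one} := measureReal_nonneg
  have hp1 : ρ.real {one} ≤ 1 := measureReal_le_one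
  rw [hrep, hrep g]
  set p := ρ.real {one}
  have hsq : (g one - g o) ^ 2 ≤ r ^ 2 := by
    rw [← sq_abs]; exact pow_le_pow_left₀ (abs_nonneg _) (hr one o) 2
  calc _ = (1 - p) * p * (g one - g o) ^ 2 := by ring
    _ ≤ _ := mul_le_mul_of_nonneg_left hsq (mul_nonneg (by linarith) hp0)

lemma exists_interval_of_abs_sub_le {α : Type*} {g : α → ℝ} {A : Set α} (hA : A.Nonempty)
    {r : ℝ} (h : ∀ a ∈ A, ∀ b ∈ A, |g a - g b| ≤ r) :
    ∃ l, ∀ a ∈ A, g a ∈ Set.Icc l (l + r) := by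
  obtain ⟨a₀, ha₀⟩ := hA
  have hbdd : BddBelow (g '' A) := ⟨g a₀ - r, by
    rintro _ ⟨a, ha, rfl⟩
    linarith [(abs_le.1 (h a ha a₀ ha₀)).1]⟩
  refine ⟨sInf (g '' A), fun a ha => ⟨csInf_le hbdd ⟨a, ha, rfl⟩, ?_⟩⟩
  rw [← sub_le_iff_le_add]
  refine le_csInf ⟨_, a₀, ha₀, rfl⟩ ?_
  rintro _ ⟨b, hb, rfl⟩
  linarith [(abs_le.1 (h a ha b hb)).2]

end Variance

/-! ### From properties of increments to tail bounds -/

section Increments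

variable {N : ℕ} {Λ : Fin N → Type*} [∀ k, MeasurableSpace (Λ k)]

/-- The conditional probability of the complement of `Γ` given the coordinates in `S`. -/
noncomputable def condBad (ν : ∀ k, Measure (Λ k)) (Γ : Set (∀ k, Λ k)) (S : Finset (Fin N))
    (x : ∀ k, Λ k) : ℝ :=
  condMean ν (Γᶜ.indicator fun _ => 1) S x

/-- The outcomes for which `Γ` is still likely when step `i` of `τ` exposes a new index. -/
def goodAt (ν : ∀ k, Measure (Λ k)) (τ : QueryStrategy Λ) (Γ : Set (∀ k, Λ k)) (γ : Fin N → ℝ)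
    (i : ℕ) : Set (∀ k, Λ k) :=
  {x | τ.query i x ∉ τ.exposed i x → condBad ν Γ (τ.exposed i x) x ≤ γ (τ.query i x)}

variable (ν : ∀ k, Measure (Λ k)) {σ τ : QueryStrategy Λ} {Γ : Set (∀ k, Λ k)} {γ : Fin N → ℝ}
  {f : (∀ k, Λ k) → ℝ}

lemma goodAt_congr (i : ℕ) (x y : ∀ k, Λ k) (h : ∀ j ∈ τ.exposed i x, x j = y j) :
    x ∈ goodAt ν τ Γ γ i ↔ y ∈ goodAt ν τ Γ γ i := by
  simp only [goodAt, Set.mem_ofPred_eq, condBad]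
  rw [← QueryStrategy.query_congr h le_rfl, ← QueryStrategy.exposed_congr h (Nat.le_succ i),
    condMean_congr ν h]

lemma abs_indicator_one_le {α : Type*} (A : Set α) (x : α) : |A.indicator (fun _ => (1 : ℝ)) x| ≤ 1 := by
  by_cases h : x ∈ A <;> simp [h]

variable [∀ k, IsProbabilityMeasure (ν k)]

lemma measurableSet_goodAt (hΓ : MeasurableSet Γ) (i : ℕ) :
    MeasurableSet (goodAt ν τ Γ γ i) := by
  have hc : Measurable fun x => condBad ν Γ (τ.exposed i x) x :=
    measurable_apply_finset (τ.measurable_exposed i)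
      fun s => measurable_condMean ν (measurable_const.indicator hΓ.compl) s
  have hfin : goodAt ν τ Γ γ i = ⋂ k, ({x | τ.query i x = k} ∩ {x | k ∉ τ.exposed i x} ∩
      {x | γ k < condBad ν Γ (τ.exposed i x) x})ᶜ := by
    ext x
    simp only [goodAt, Set.mem_ofPred_eq, Set.mem_iInter, Set.mem_compl_iff, Set.mem_inter_iff,
      not_and, not_lt]
    constructor
    · rintro h k ⟨rfl, hk⟩
      exact h hk
    · intro h hk
      exact h _ ⟨rfl, hk⟩
  rw [hfin]
  refine .iInter fun k => MeasurableSet.compl (.inter (.inter ?_ ?_) ?_)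
  · exact τ.measurable_query i (measurableSet_singleton k)
  · exact (τ.measurable_exposed i (measurableSet_mem_finset k)).compl
  · exact measurableSet_lt measurable_const hc

/-- All increments of the exposure of `f` by `τ` that matter have the property `Φ`. -/
def IncrementsSatisfy (τ : QueryStrategy Λ) (Γ : Set (∀ k, Λ k)) (γ : Fin N → ℝ)
    (f : (∀ k, Λ k) → ℝ) (Φ : ∀ k, (Λ k → ℝ) → Prop) : Prop :=
  ∀ i, ∀ᵐ x ∂Measure.pi ν, x ∈ goodAt ν τ Γ γ i → τ.query i x ∉ τ.exposed i x →
    Φ (τ.query i x) (fibreMean ν f (τ.exposed i x) x (τ.query i x))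

variable {ν} {B : Set (∀ k, Λ k)} {t K : ℝ}

/-- The exponential estimate `hΦ` is required only at indices that occur in some query set, since
`maxMax` bounds the coefficients only there. -/
lemma tail_le_of_increments {v : Fin N → ℝ} {lam W : ℝ} {Φ : ∀ k, (Λ k → ℝ) → Prop}
    (hR : QueryStrategy.Refines σ τ)
    (hf : Measurable f) (hK : ∀ x, |f x| ≤ K) (hdet : σ.Determines f) (hΓ : MeasurableSet Γ)
    (hB : ∀ᵐ x ∂Measure.pi ν, x ∉ B → ∀ i, x ∈ goodAt ν τ Γ γ i)
    (hinc : IncrementsSatisfy ν τ Γ γ f Φ)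
    (hlam : 0 ≤ lam) (hW : ∀ x, ∑ k ∈ σ.queried x, v k ≤ W)
    (hΦ : ∀ k, (∃ x, k ∈ σ.queried x) → ∀ g : Λ k → ℝ, Measurable g → (∀ a, |g a| ≤ K) → Φ k g →
      ∫ a, Real.exp (lam * (g a - ∫ b, g b ∂ν k)) ∂ν k ≤ Real.exp (v k)) :
    (Measure.pi ν).real {x | ∫ y, f y ∂Measure.pi ν + t ≤ f x ∧ x ∉ B} ≤
      Real.exp (-lam * t + W) := by
  refine le_trans ?_ (exposure_tail_le (ν := ν) (t := t) (H := goodAt ν τ Γ γ) hR hf hK hdet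
    (fun i => measurableSet_goodAt ν hΓ i) (fun i x y h => goodAt_congr ν i x y h) hlam hW
    fun i => ?_)
  · refine ENNReal.toReal_mono (measure_ne_top _ _) (measure_mono_ae ?_)
    filter_upwards [hB] with x hx h
    exact ⟨h.1, hx h.2⟩
  · filter_upwards [hinc i] with x hx h1 h2 h3
    rw [← integral_fibreMean ν hf hK h2 x]
    exact hΦ _ ⟨x, h3⟩ _ (measurable_fibreMean ν hf _ _ _) (abs_fibreMean_le ν hK _ _ _)
      (hx h1 h2)

/-- The Hoeffding-type tail bound. -/
lemma hoeffding_tail_le {r : Fin N → ℝ}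
    (hR : QueryStrategy.Refines σ τ)
    (hf : Measurable f) (hK : ∀ x, |f x| ≤ K) (hdet : σ.Determines f) (hΓ : MeasurableSet Γ)
    (hB : ∀ᵐ x ∂Measure.pi ν, x ∉ B → ∀ i, x ∈ goodAt ν τ Γ γ i)
    (hinc : IncrementsSatisfy ν τ Γ γ f
      fun k g => ∃ l, ∀ᵐ a ∂ν k, g a ∈ Set.Icc l (l + r k)) (ht : 0 ≤ t) :
    (Measure.pi ν).real {x | ∫ y, f y ∂Measure.pi ν + t ≤ f x ∧ x ∉ B} ≤
      expNegDiv (2 * t ^ 2) (σ.maxSum fun k => r k ^ 2) := by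
  refine le_expNegDiv_of_chernoff ht (σ.maxSum_nonneg fun k => sq_nonneg _) fun lam hlam => ?_
  refine tail_le_of_increments (v := fun k => lam ^ 2 * r k ^ 2 / 8) hR hf hK hdet hΓ hB hinc hlam
    (fun x => ?_) fun k _ g hg _ => ?_
  · rw [← Finset.sum_div, ← Finset.mul_sum]
    gcongr
    exact σ.sum_queried_le_maxSum (fun k => r k ^ 2) x
  · rintro ⟨l, hl⟩
    simpa using hoeffding_mgf_le hg hl lam

/-- The Bernstein- and Bennett-type tail bounds. -/
lemma bennett_tail_le {C w : Fin N → ℝ}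
    (hR : QueryStrategy.Refines σ τ)
    (hf : Measurable f) (hK : ∀ x, |f x| ≤ K) (hdet : σ.Determines f) (hΓ : MeasurableSet Γ)
    (hB : ∀ᵐ x ∂Measure.pi ν, x ∉ B → ∀ i, x ∈ goodAt ν τ Γ γ i)
    (hinc : IncrementsSatisfy ν τ Γ γ f fun k g =>
      (∀ᵐ a ∂ν k, g a - ∫ b, g b ∂ν k ≤ C k) ∧ ∫ a, (g a - ∫ b, g b ∂ν k) ^ 2 ∂ν k ≤ w k)
    (hC : ∀ k, 0 ≤ C k) (hw : ∀ k, 0 ≤ w k) (hwC : ∀ k, 0 < w k → 0 < C k) (ht : 0 ≤ t) :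
    (Measure.pi ν).real {x | ∫ y, f y ∂Measure.pi ν + t ≤ f x ∧ x ∉ B} ≤
        bernsteinBound (σ.maxSum w) (σ.maxMax C) t ∧
    (Measure.pi ν).real {x | ∫ y, f y ∂Measure.pi ν + t ≤ f x ∧ x ∉ B} ≤
        bennettBound (σ.maxSum w) (σ.maxMax C) t := by
  refine le_bernstein_bennett_of_chernoff ht (σ.maxSum_nonneg hw) (σ.maxMax_nonneg hC) ?_ ?_
  · intro hV
    by_contra! hC0
    refine hV.not_ge (Real.iSup_le ?_ le_rfl)
    rintro ⟨_, x, rfl⟩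
    refine Finset.sum_nonpos fun k hk => ?_
    by_contra! hk0
    exact absurd ((hwC k hk0).trans_le ((σ.le_maxMax C hk).trans hC0)) (lt_irrefl _)
  · intro C' hC'0 hC' lam hlam
    set κ := (Real.exp (lam * C') - 1 - lam * C') / C' ^ 2 with hκ
    have hκ0 : 0 ≤ κ := div_nonneg (by linarith [Real.add_one_le_exp (lam * C')]) (sq_nonneg _)
    refine tail_le_of_increments (v := fun k => w k * κ) hR hf hK hdet hΓ hB hinc hlam
      (fun x => ?_) fun k hk g hg hgK => ?_
    · rw [← Finset.sum_mul]
      exact mul_le_mul_of_nonneg_right (σ.sum_queried_le_maxSum w x) hκ0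
    · rintro ⟨h1, h2⟩
      obtain ⟨x, hx⟩ := hk
      refine bennett_mgf_le hg hgK hC'0 hlam ?_ h2
      filter_upwards [h1] with a ha
      exact ha.trans ((σ.le_maxMax C hx).trans hC')

end Increments

lemma QueryStrategy.maxSum_const_mul {N : ℕ} {Λ : Fin N → Type*} [∀ k, MeasurableSpace (Λ k)]
    (σ : QueryStrategy Λ) {r : ℝ} (hr : 0 ≤ r) (a : Fin N → ℝ) :
    (σ.maxSum fun k => r * a k) = r * σ.maxSum a := by
  unfold QueryStrategy.maxSum
  rw [Real.mul_iSup_of_nonneg hr]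
  simp_rw [Finset.mul_sum]

/-! ### Consequences of coordinatewise difference bounds -/

section Differences

variable {N : ℕ} {Λ : Fin N → Type*} {f : (∀ k, Λ k) → ℝ}

lemma differOnlyAt_update (z : ∀ k, Λ k) (k : Fin N) (a b : Λ k) :
    DifferOnlyAt k (Function.update z k a) (Function.update z k b) := fun j hj => by
  rw [Function.update_of_ne hj, Function.update_of_ne hj]

lemma exists_abs_le_of_differences {D : ℝ} (h : ∀ x y, |f x - f y| ≤ D) :
    ∃ K, ∀ x, |f x| ≤ K := by
  rcases isEmpty_or_nonempty (∀ k, Λ k) with he | ⟨⟨z⟩⟩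
  · exact ⟨0, fun x => he.elim x⟩
  · refine ⟨D + |f z|, fun x => ?_⟩
    have := abs_add_le (f x - f z) (f z)
    rw [sub_add_cancel] at this
    exact this.trans (add_le_add_left (h x z) _)

lemma abs_sub_le_sum_of_differences {d : Fin N → ℝ}
    (h : ∀ k x y, DifferOnlyAt k x y → |f x - f y| ≤ d k) (x y : ∀ k, Λ k) :
    |f x - f y| ≤ ∑ k, d k := by
  have key : ∀ S : Finset (Fin N), |f (S.piecewise x y) - f y| ≤ ∑ k ∈ S, d k := by
    intro S
    induction S using Finset.induction_on with
    | empty => simp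
    | insert k S hk ih =>
      rw [Finset.sum_insert hk]
      refine (abs_sub_le _ (f (S.piecewise x y)) _).trans (add_le_add (h k _ _ ?_) ih)
      intro j hj
      rw [Finset.piecewise_insert, Function.update_of_ne hj]
  simpa using key Finset.univ

lemma update_piecewise_mem_pi {G : ∀ k, Set (Λ k)} {S : Finset (Fin N)} {x y : ∀ k, Λ k} {k : Fin N} {a : Λ k}
    (hx : x ∈ Set.univ.pi G) (hy : y ∈ Set.univ.pi G) (ha : a ∈ G k) :
    Function.update (S.piecewise x y) k a ∈ Set.univ.pi G := by
  intro j _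
  by_cases hj : j = k
  · subst hj; simpa using ha
  · rw [Function.update_of_ne hj]
    by_cases hS : j ∈ S
    · simpa [hS] using hx j trivial
    · simpa [hS] using hy j trivial

end Differences

/-! ### Increments under the typical Lipschitz conditions -/

section Typical

variable {N : ℕ} {Λ : Fin N → Type*} [∀ k, MeasurableSpace (Λ k)]
  {ν : ∀ k, Measure (Λ k)} [∀ k, IsProbabilityMeasure (ν k)] {σ τ : QueryStrategy Λ}
  {Γ B : Set (∀ k, Λ k)} {γ : Fin N → ℝ} {f : (∀ k, Λ k) → ℝ} {K t : ℝ}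
  {G : ∀ k, Set (Λ k)} {c d e : Fin N → ℝ}

lemma ae_mem_pi (hG : ∀ k, ∀ᵐ a ∂ν k, a ∈ G k) : ∀ᵐ x ∂Measure.pi ν, x ∈ Set.univ.pi G := by
  have : ∀ k, ∀ᵐ x ∂Measure.pi ν, x k ∈ G k := fun k =>
    (measurePreserving_eval ν k).quasiMeasurePreserving.ae (hG k)
  filter_upwards [ae_all_iff.2 this] with x hx k _ using hx k

lemma measurable_update_piecewise (S : Finset (Fin N)) (x : ∀ k, Λ k) (k : Fin N) (a : Λ k) :
    Measurable fun y => Function.update (S.piecewise x y) k a :=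
  (measurable_update_pair k).comp
    (((measurable_piecewise_pair S).comp measurable_prodMk_left).prodMk measurable_const)

/-- Both means integrate over the same `y`. This couples the two arguments so that they differ in
coordinate `k` only, and Lipschitz bounds can be applied under the integral. -/
lemma abs_fibreMean_sub_le (hf : Measurable f) (hK : ∀ x, |f x| ≤ K)
    (hG : ∀ k, ∀ᵐ a ∂ν k, a ∈ G k) {S : Finset (Fin N)} {x : ∀ k, Λ k} {k : Fin N} {a b : Λ k}
    {ψ : (∀ k, Λ k) → ℝ} (hψ : Integrable ψ (Measure.pi ν))
    (h : ∀ y ∈ Set.univ.pi G, |f (Function.update (S.piecewise x y) k a) -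
      f (Function.update (S.piecewise x y) k b)| ≤ ψ y) :
    |fibreMean ν f S x k a - fibreMean ν f S x k b| ≤ ∫ y, ψ y ∂Measure.pi ν := by
  have hi : ∀ a, Integrable (fun y => f (Function.update (S.piecewise x y) k a)) (Measure.pi ν) :=
    fun a => integrable_of_abs_le (hf.comp (measurable_update_piecewise S x k a)) fun _ => hK _
  unfold fibreMean
  rw [← integral_sub (hi a) (hi b)]
  refine abs_integral_le_integral_abs.trans ?_
  refine integral_mono_ae ((hi a).sub (hi b)).abs hψ ?_
  filter_upwards [ae_mem_pi hG] with y hy using h y hy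

lemma integrable_indicator_update (hΓ : MeasurableSet Γ) (S : Finset (Fin N)) (x : ∀ k, Λ k)
    (k : Fin N) (a : Λ k) : Integrable (fun y => Γᶜ.indicator (fun _ => (1 : ℝ))
      (Function.update (S.piecewise x y) k a)) (Measure.pi ν) :=
  integrable_of_abs_le ((measurable_const.indicator hΓ.compl).comp
    (measurable_update_piecewise S x k a)) fun _ => abs_indicator_one_le _ _

/-- Under the typical Lipschitz condition, an increment is controlled by the conditional
probability of the bad event. -/
lemma abs_fibreMean_sub_le_of_typical (hf : Measurable f) (hK : ∀ x, |f x| ≤ K)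
    (hΓ : MeasurableSet Γ) (hG : ∀ k, ∀ᵐ a ∂ν k, a ∈ G k)
    (hTL : TypicalLipschitzOn (Set.univ.pi G) Γ f c d) {S : Finset (Fin N)} {x : ∀ k, Λ k}
    (hx : x ∈ Set.univ.pi G) {k : Fin N} {a b : Λ k} (ha : a ∈ G k) (hb : b ∈ G k) :
    |fibreMean ν f S x k a - fibreMean ν f S x k b| ≤
      c k + (d k - c k) * fibreMean ν (Γᶜ.indicator fun _ => 1) S x k a := by
  have hi := integrable_indicator_update (ν := ν) hΓ S x k a
  refine (abs_fibreMean_sub_le hf hK hG ((integrable_const (c k)).add (hi.const_mul (d k - c k)))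
    fun y hy => ?_).trans_eq ?_
  · have := hTL.2 k _ (update_piecewise_mem_pi (S := S) hx hy ha) _
      (update_piecewise_mem_pi (S := S) hx hy hb) (differOnlyAt_update _ k a b)
    by_cases hm : Function.update (S.piecewise x y) k a ∈ Γ
    · simpa [hm] using this.1 hm
    · simpa [hm] using this.2 hm
  · simp only [Pi.add_apply]
    rw [integral_add (integrable_const _) (hi.const_mul _), integral_const_mul]
    simp [fibreMean]

/-- The larger constant is now needed when either point leaves `Γ`, so both failure probabilities
enter. This is the source of the factor `2` in the error term. -/
lemma abs_fibreMean_sub_le_of_twoSided (hf : Measurable f) (hK : ∀ x, |f x| ≤ K)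
    (hΓ : MeasurableSet Γ) (hTL : TwoSidedTypicalLipschitz Γ f c d) (S : Finset (Fin N))
    (x : ∀ k, Λ k) (k : Fin N) (a b : Λ k) :
    |fibreMean ν f S x k a - fibreMean ν f S x k b| ≤
      c k + (d k - c k) * (fibreMean ν (Γᶜ.indicator fun _ => 1) S x k a +
        fibreMean ν (Γᶜ.indicator fun _ => 1) S x k b) := by
  have hi := fun a => integrable_indicator_update (ν := ν) hΓ S x k a
  have hi' : Integrable (fun y => Γᶜ.indicator (fun _ => (1 : ℝ))
      (Function.update (S.piecewise x y) k a) + Γᶜ.indicator (fun _ => (1 : ℝ))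
      (Function.update (S.piecewise x y) k b)) (Measure.pi ν) := (hi a).add (hi b)
  refine (abs_fibreMean_sub_le (G := fun _ => Set.univ) hf hK (by simp)
    ((integrable_const (c k)).add (hi'.const_mul (d k - c k)))
    fun y _ => ?_).trans_eq ?_
  · have := hTL.2 k _ _ (differOnlyAt_update (S.piecewise x y) k a b)
    have hcd := hTL.1 k
    by_cases hm : Function.update (S.piecewise x y) k a ∈ Γ <;>
      by_cases hm' : Function.update (S.piecewise x y) k b ∈ Γ
    · simpa [hm, hm'] using this.1 ⟨hm, hm'⟩
    · simpa [hm, hm'] using this.2 (by tauto)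
    · simpa [hm, hm'] using this.2 (by tauto)
    · have := this.2 (by tauto)
      simp [hm, hm']
      linarith
  · simp only [Pi.add_apply]
    rw [integral_add (integrable_const _) (hi'.const_mul _), integral_const_mul,
      integral_add (hi a) (hi b)]
    simp [fibreMean]

/-- An increment bounded by means of a conditional probability `φ` of the bad event. -/
def TypicalIncrement (ν : ∀ k, Measure (Λ k)) (G : ∀ k, Set (Λ k)) (γ c d : Fin N → ℝ)
    (k : Fin N) (g : Λ k → ℝ) : Prop :=
  ∃ φ : Λ k → ℝ, Integrable φ (ν k) ∧ (∀ a, 0 ≤ φ a) ∧ ∫ a, φ a ∂ν k ≤ γ k ∧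
    ∀ a ∈ G k, ∀ b ∈ G k, |g a - g b| ≤ c k + (d k - c k) * φ a

/-- `φ` is the failure probability after the new value is seen. By the martingale property its mean
is the one before, which `goodAt` bounds. -/
lemma fibreMean_indicator_properties (hΓ : MeasurableSet Γ) {i : ℕ} {x : ∀ k, Λ k}
    (hx : x ∈ goodAt ν τ Γ γ i) (hk : τ.query i x ∉ τ.exposed i x) :
    let φ := fibreMean ν (Γᶜ.indicator fun _ => 1) (τ.exposed i x) x (τ.query i x)
    Integrable φ (ν (τ.query i x)) ∧ (∀ a, 0 ≤ φ a) ∧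
      ∫ a, φ a ∂ν (τ.query i x) ≤ γ (τ.query i x) := by
  have hm : Measurable (Γᶜ.indicator fun _ => (1 : ℝ)) := measurable_const.indicator hΓ.compl
  refine ⟨integrable_of_abs_le (measurable_fibreMean ν hm _ _ _)
    (abs_fibreMean_le ν (abs_indicator_one_le _) _ _ _), fun a => ?_, ?_⟩
  · exact integral_nonneg fun y => Set.indicator_nonneg (fun _ _ => zero_le_one) _
  · rw [integral_fibreMean ν hm (abs_indicator_one_le _) hk]
    exact hx hk

lemma incrementsSatisfy_of_typical (hf : Measurable f) (hK : ∀ x, |f x| ≤ K)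
    (hΓ : MeasurableSet Γ) (hG : ∀ k, ∀ᵐ a ∂ν k, a ∈ G k)
    (hTL : TypicalLipschitzOn (Set.univ.pi G) Γ f c d) :
    IncrementsSatisfy ν τ Γ γ f (TypicalIncrement ν G γ c d) := by
  intro i
  filter_upwards [ae_mem_pi hG] with x hx hgood hk
  obtain ⟨h1, h2, h3⟩ := fibreMean_indicator_properties hΓ hgood hk
  exact ⟨_, h1, h2, h3, fun a ha b hb =>
    abs_fibreMean_sub_le_of_typical hf hK hΓ hG hTL hx ha hb⟩

/-- The one-sided bound is applied at the point `a` that is integrated, not at `b`: only the average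
of `φ` is at most `γ k`, while `φ b` may be large. -/
lemma TypicalIncrement.abs_sub_integral_le {k : Fin N} {g : Λ k → ℝ}
    (h : TypicalIncrement ν G γ c d k g) (hg : Measurable g) (hK : ∀ a, |g a| ≤ K)
    (hG : ∀ᵐ a ∂ν k, a ∈ G k) (hcd : c k ≤ d k) {b : Λ k} (hb : b ∈ G k) :
    |g b - ∫ a, g a ∂ν k| ≤ c k + γ k * (d k - c k) := by
  obtain ⟨φ, hφ, -, hφγ, hinc⟩ := h
  have hi : Integrable g (ν k) := integrable_of_abs_le hg hK
  have : g b - ∫ a, g a ∂ν k = ∫ a, (g b - g a) ∂ν k := by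
    rw [integral_sub (integrable_const _) hi]; simp
  rw [this]
  refine abs_integral_le_integral_abs.trans ?_
  calc _ ≤ ∫ a, (c k + (d k - c k) * φ a) ∂ν k := by
        refine integral_mono_ae ((integrable_const _).sub hi).abs
          ((integrable_const _).add (hφ.const_mul _)) ?_
        filter_upwards [hG] with a ha
        change |g b - g a| ≤ _
        rw [abs_sub_comm]
        exact hinc a ha b hb
    _ = c k + (d k - c k) * ∫ a, φ a ∂ν k := by
        rw [integral_add (integrable_const _) (hφ.const_mul _), integral_const_mul]; simp
    _ ≤ c k + γ k * (d k - c k) := by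
        rw [mul_comm (γ k)]
        gcongr

/-- The properties of the increments from which all tail bounds are derived. -/
def ControlledIncrement (ν : ∀ k, Measure (Λ k)) (c e : Fin N → ℝ) (k : Fin N) (g : Λ k → ℝ) :
    Prop :=
  (∀ a, |g a - ∫ b, g b ∂ν k| ≤ c k + e k) ∧
  (Nat.card (Λ k) = 2 → ∀ a b, |g a - g b| ≤ c k + e k) ∧
  ∀ p η, p < 1 → 1 - p ≤ (ν k).real {η} → ∀ a, |g a - g η| ≤ c k + e k * (1 - p)⁻¹

lemma TypicalIncrement.controlled [∀ k, MeasurableSingletonClass (Λ k)] {k : Fin N} {g : Λ k → ℝ}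
    (h : TypicalIncrement ν (fun _ => Set.univ) γ c d k g) (hg : Measurable g)
    (hK : ∀ a, |g a| ≤ K) (hcd : c k ≤ d k) :
    ControlledIncrement ν c (fun k => γ k * (d k - c k)) k g := by
  refine ⟨fun b => h.abs_sub_integral_le hg hK (by simp) hcd trivial, fun hcard a b => ?_,
    fun p η hp hη a => ?_⟩
  · obtain ⟨φ, hφ, -, hφγ, hinc⟩ := h
    -- For equal points the claim is nonnegativity of the bound, obtained by integrating the
    -- nonnegative function `c k + (d k - c k) * φ`.
    rcases eq_or_ne a b with rfl | hab
    · have h1 : ∀ z, 0 ≤ c k + (d k - c k) * φ z := fun z =>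
        (abs_nonneg _).trans (hinc z trivial z trivial)
      have h2 : 0 ≤ ∫ z, (c k + (d k - c k) * φ z) ∂ν k := integral_nonneg h1
      rw [integral_add (integrable_const _) (hφ.const_mul _), integral_const_mul] at h2
      simp only [integral_const, probReal_univ, smul_eq_mul, one_mul] at h2
      simp only [sub_self, abs_zero]
      nlinarith [mul_le_mul_of_nonneg_left hφγ (sub_nonneg.2 hcd)]
    · have hz : ∀ z, z = a ∨ z = b := by
        obtain ⟨o, ho, hall⟩ := exists_other_of_card_two hcard a
        rcases hall b with rfl | rfl
        · exact absurd rfl hab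
        · exact hall
      -- On two points the minimum of `φ` is at most its mean, and the Lipschitz bound may be
      -- started from whichever point has the smaller `φ`.
      have hmin : min (φ a) (φ b) ≤ γ k := by
        refine le_trans ?_ hφγ
        have : ∫ _, min (φ a) (φ b) ∂ν k ≤ ∫ z, φ z ∂ν k := by
          refine integral_mono (integrable_const _) hφ fun z => ?_
          rcases hz z with rfl | rfl
          · exact min_le_left _ _
          · exact min_le_right _ _
        simpa using this
      have hle : |g a - g b| ≤ c k + (d k - c k) * min (φ a) (φ b) := by
        rcases min_choice (φ a) (φ b) with h' | h' <;> rw [h']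
        · exact hinc a trivial b trivial
        · rw [abs_sub_comm]; exact hinc b trivial a trivial
      refine hle.trans ?_
      change _ ≤ c k + γ k * (d k - c k)
      rw [mul_comm (γ k)]
      gcongr
  · obtain ⟨φ, hφ, hφ0, hφγ, hinc⟩ := h
    have hp' : 0 < 1 - p := by linarith
    -- A heavy atom contributes at least `φ η * (1 - p)` to the mean of `φ`.
    have hφη : φ η * (1 - p) ≤ γ k := by
      refine le_trans ?_ hφγ
      calc φ η * (1 - p) ≤ φ η * (ν k).real {η} := mul_le_mul_of_nonneg_left hη (hφ0 η)
        _ = ∫ z, ({η} : Set (Λ k)).indicator (fun _ => φ η) z ∂ν k := by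
          rw [integral_indicator_const _ (measurableSet_singleton η), smul_eq_mul, mul_comm]
        _ ≤ _ := by
          refine integral_mono ((integrable_const _).indicator (measurableSet_singleton η)) hφ ?_
          intro z
          by_cases hzη : z = η
          · simp [hzη]
          · simpa [hzη] using hφ0 z
    rw [abs_sub_comm]
    refine (hinc η trivial a trivial).trans ?_
    have : φ η ≤ γ k * (1 - p)⁻¹ := by rwa [← div_eq_mul_inv, le_div_iff₀ hp']
    nlinarith [mul_le_mul_of_nonneg_left this (sub_nonneg.2 hcd)]

lemma controlledIncrement_of_abs_sub_le [∀ k, MeasurableSingletonClass (Λ k)] {k : Fin N}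
    {g : Λ k → ℝ} (hg : Measurable g) (hK : ∀ a, |g a| ≤ K) (he : 0 ≤ e k)
    (h : ∀ a b, |g a - g b| ≤ c k + e k) : ControlledIncrement ν c e k g := by
  refine ⟨fun a => ?_, fun _ => h, fun p η hp hη a => (h a η).trans ?_⟩
  · have hi : Integrable g (ν k) := integrable_of_abs_le hg hK
    have : g a - ∫ b, g b ∂ν k = ∫ b, (g a - g b) ∂ν k := by
      rw [integral_sub (integrable_const _) hi]; simp
    rw [this]
    exact abs_integral_le_of_abs_le _ (h a)
  · have hp0 : 1 - p ≤ 1 := hη.trans measureReal_le_one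
    have : 1 ≤ (1 - p)⁻¹ := (one_le_inv₀ (by linarith)).2 hp0
    nlinarith

lemma incrementsSatisfy_of_twoSided [∀ k, MeasurableSingletonClass (Λ k)]
    (hf : Measurable f) (hK : ∀ x, |f x| ≤ K)
    (hΓ : MeasurableSet Γ) (hTL : TwoSidedTypicalLipschitz Γ f c d) (hγ : ∀ k, 0 ≤ γ k)
    {q : Fin N → ℝ} (hq : ∀ k, 0 < q k ∧ ∀ η, q k ≤ (ν k).real {η}) :
    IncrementsSatisfy ν τ Γ γ f
      (ControlledIncrement ν c fun k => 2 * γ k * (d k - c k) * (q k)⁻¹) := by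
  refine fun i => .of_forall fun x hgood hk => ?_
  obtain ⟨h1, h2, h3⟩ := fibreMean_indicator_properties hΓ hgood hk
  set k := τ.query i x
  set φ := fibreMean ν (Γᶜ.indicator fun _ => 1) (τ.exposed i x) x k
  have hcd := sub_nonneg.2 (hTL.1 k)
  have hq0 := (hq k).1
  -- As every atom has mass at least `q k`, the bound on the mean of `φ` becomes a pointwise one.
  have hφ : ∀ η, φ η ≤ γ k * (q k)⁻¹ := fun η => by
    rw [← div_eq_mul_inv, le_div_iff₀ hq0]
    refine le_trans ?_ h3
    calc φ η * q k ≤ φ η * (ν k).real {η} := mul_le_mul_of_nonneg_left ((hq k).2 η) (h2 η)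
      _ = ∫ z, ({η} : Set (Λ k)).indicator (fun _ => φ η) z ∂ν k := by
        rw [integral_indicator_const _ (measurableSet_singleton η), smul_eq_mul, mul_comm]
      _ ≤ _ := by
        refine integral_mono ((integrable_const _).indicator (measurableSet_singleton η)) h1 ?_
        intro z
        by_cases hzη : z = η
        · simp [hzη]
        · simpa [hzη] using h2 z
  refine controlledIncrement_of_abs_sub_le (measurable_fibreMean ν hf _ _ _)
    (abs_fibreMean_le ν hK _ _ _) ?_ fun a b => ?_
  · have := hγ k
    positivity
  · refine (abs_fibreMean_sub_le_of_twoSided hf hK hΓ hTL _ x k a b).trans ?_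
    have := mul_le_mul_of_nonneg_left (add_le_add (hφ a) (hφ b)) hcd
    simp only [φ] at this
    linarith

lemma IncrementsSatisfy.mono {Φ Φ' : ∀ k, (Λ k → ℝ) → Prop} (hf : Measurable f)
    (hK : ∀ x, |f x| ≤ K) (h : IncrementsSatisfy ν τ Γ γ f Φ)
    (hΦ : ∀ k g, Measurable g → (∀ a, |g a| ≤ K) → Φ k g → Φ' k g) :
    IncrementsSatisfy ν τ Γ γ f Φ' := fun i => by
  filter_upwards [h i] with x hx h1 h2
  exact hΦ _ _ (measurable_fibreMean ν hf _ _ _) (abs_fibreMean_le ν hK _ _ _) (hx h1 h2)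

/-- The Azuma-type tail bound. -/
lemma azuma_tail_le {r : Fin N → ℝ} (hR : QueryStrategy.Refines σ τ)
    (hf : Measurable f) (hK : ∀ x, |f x| ≤ K) (hdet : σ.Determines f) (hΓ : MeasurableSet Γ)
    (hB : ∀ᵐ x ∂Measure.pi ν, x ∉ B → ∀ i, x ∈ goodAt ν τ Γ γ i)
    (hinc : IncrementsSatisfy ν τ Γ γ f
      fun k g => ∀ᵐ a ∂ν k, |g a - ∫ b, g b ∂ν k| ≤ r k) (ht : 0 ≤ t) :
    (Measure.pi ν).real {x | ∫ y, f y ∂Measure.pi ν + t ≤ f x ∧ x ∉ B} ≤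
      expNegDiv (t ^ 2) (2 * σ.maxSum fun k => r k ^ 2) := by
  -- A deviation of at most `r k` from the mean gives only an interval of length `2 * r k`, which
  -- costs a factor `4` in the exponent.
  have h := hoeffding_tail_le (r := fun k => 2 * r k) hR hf hK hdet hΓ hB
    (hinc.mono hf hK fun k g _ _ hg => ⟨∫ b, g b ∂ν k - r k, by
      filter_upwards [hg] with a ha
      rw [abs_le] at ha
      constructor <;> linarith⟩) ht
  refine h.trans_eq ?_
  simp_rw [mul_pow]
  rw [σ.maxSum_const_mul (by norm_num), ← expNegDiv_mul_left two_ne_zero (t ^ 2)]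
  congr 1
  ring

end Typical

/-! ### Transfer to the law of the random variables -/

section Tail

variable {N : ℕ} {Λ : Fin N → Type*} {Ω : Type*} [MeasurableSpace Ω] {P : Measure Ω}
  {X : ∀ k, Ω → Λ k} {f : (∀ k, Λ k) → ℝ} {B : Set (∀ k, Λ k)}

lemma tail_eq_tailOff (s : ℝ) : tail P X f s = tailOff P X f ∅ s := by
  simp [tail, tailOff]

lemma tailOff_eq_zero (hB : ∀ x, x ∈ B) (s : ℝ) : tailOff P X f B s = 0 := by
  simp [tailOff, hB]

end Tail

section Law

variable {N : ℕ} {Λ : Fin N → Type*} [∀ k, MeasurableSpace (Λ k)] {Ω : Type*} [MeasurableSpace Ω]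
  {P : Measure Ω} {X : ∀ k, Ω → Λ k}
  {f : (∀ k, Λ k) → ℝ} {B : Set (∀ k, Λ k)}

lemma probIn_eq (hX : ∀ k, Measurable (X k)) (hind : iIndepFun X P) (hB : MeasurableSet B) :
    probIn P X B = (Measure.pi fun k => P.map (X k)).real B := by
  rw [← hind.map_fun_eq_pi_map fun k => (hX k).aemeasurable,
    map_measureReal_apply (measurable_pi_lambda _ hX) hB]
  rfl

lemma integral_law_eq (hX : ∀ k, Measurable (X k)) (hind : iIndepFun X P) (hf : Measurable f) :
    ∫ ω, f (fun k => X k ω) ∂P = ∫ x, f x ∂(Measure.pi fun k => P.map (X k)) := by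
  rw [← hind.map_fun_eq_pi_map fun k => (hX k).aemeasurable,
    integral_map (measurable_pi_lambda _ hX).aemeasurable hf.aestronglyMeasurable]

lemma tailOff_eq (hX : ∀ k, Measurable (X k)) (hind : iIndepFun X P) (hf : Measurable f)
    (hB : MeasurableSet B) (s : ℝ) :
    tailOff P X f B s = (Measure.pi fun k => P.map (X k)).real
      {x | ∫ y, f y ∂(Measure.pi fun k => P.map (X k)) + s ≤ f x ∧ x ∉ B} := by
  rw [← integral_law_eq hX hind hf]
  exact probIn_eq hX hind ((measurableSet_le measurable_const hf).inter hB.compl)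

lemma tailsOff_of_forall_mem {σ : QueryStrategy Λ} {c e : Fin N → ℝ} (hB : ∀ x, x ∈ B) :
    TailsOff P X σ B f c e := by
  intro t _
  rw [tailOff_eq_zero hB]
  exact ⟨expNegDiv_nonneg _ _, fun _ => expNegDiv_nonneg _ _,
    fun _ _ _ _ => ⟨expNegDiv_nonneg _ _, bennettBound_nonneg _ _ _⟩,
    fun _ _ => ⟨expNegDiv_nonneg _ _, bennettBound_nonneg _ _ _⟩⟩

variable [IsProbabilityMeasure P] [∀ k, MeasurableSingletonClass (Λ k)]

/-- The deviation from the mean gives the Azuma bound and the constant `C` in both Bennett cases.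
The range on two points gives the Hoeffding bound and the two-point variance, and the distance from
a heavy atom gives the general variance. -/
lemma tailsOff_of_controlled {σ τ : QueryStrategy Λ} {Γ : Set (∀ k, Λ k)} {γ c e : Fin N → ℝ}
    {K : ℝ} (hX : ∀ k, Measurable (X k)) (hind : iIndepFun X P)
    (hR : QueryStrategy.Refines σ τ) (hf : Measurable f) (hK : ∀ x, |f x| ≤ K)
    (hdet : σ.Determines f) (hΓ : MeasurableSet Γ) (hBm : MeasurableSet B)
    (hB : ∀ x ∉ B, ∀ i, x ∈ goodAt (fun k => P.map (X k)) τ Γ γ i)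
    (hinc : IncrementsSatisfy (fun k => P.map (X k)) τ Γ γ f
      (ControlledIncrement (fun k => P.map (X k)) c e))
    (hc : ∀ k, 0 ≤ c k) (he : ∀ k, 0 ≤ e k) : TailsOff P X σ B f c e := by
  intro t ht
  have hprob : ∀ k, IsProbabilityMeasure (P.map (X k)) := fun k =>
    Measure.isProbabilityMeasure_map (hX k).aemeasurable
  rw [tailOff_eq hX hind hf hBm]
  set ν : ∀ k, Measure (Λ k) := fun k => P.map (X k) with hν
  have hatom : ∀ k η, P.real {ω | X k ω = η} = (ν k).real {η} := fun k η =>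
    (map_measureReal_apply (hX k) (measurableSet_singleton η)).symm
  have hB' : ∀ᵐ x ∂Measure.pi ν, x ∉ B → ∀ i, x ∈ goodAt ν τ Γ γ i := .of_forall hB
  have hce : ∀ k, 0 ≤ c k + e k := fun k => add_nonneg (hc k) (he k)
  refine ⟨?_, fun hcard => ?_, fun one hcard p hp => ?_, fun p hp => ?_⟩
  · exact azuma_tail_le hR hf hK hdet hΓ hB' (hinc.mono hf hK fun k g _ _ hg =>
      .of_forall hg.1) ht
  · refine (hoeffding_tail_le (r := fun k => c k + e k) hR hf hK hdet hΓ hB'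
      (hinc.mono hf hK fun k g _ _ hg => ?_) ht).trans_eq ?_
    · obtain ⟨l, hl⟩ := exists_interval_of_abs_sub_le (g := g) (A := Set.univ)
        (@Set.univ_nonempty _ (Nat.card_pos_iff.1 (by rw [hcard k]; norm_num)).1)
        fun a _ b _ => hg.2.1 (hcard k) a b
      exact ⟨l, .of_forall fun a => hl a trivial⟩
    · rw [← expNegDiv_mul_left two_ne_zero]
      congr 1
      ring
  · simp_rw [hatom] at hp
    have hp0 : ∀ k, 0 ≤ p k := fun k => hp k ▸ measureReal_nonneg
    have hp1 : ∀ k, 0 ≤ 1 - p k := fun k => by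
      rw [hp k]; exact sub_nonneg.2 measureReal_le_one
    refine bennett_tail_le hR hf hK hdet hΓ hB' (hinc.mono hf hK fun k g _ _ hg => ⟨?_, ?_⟩)
      hce (fun k => ?_) (fun k hk => ?_) ht
    · exact .of_forall fun a => (le_abs_self _).trans (hg.1 a)
    · rw [hp k]
      exact variance_le_of_card_two (hcard k) (one k) (hg.2.1 (hcard k))
    · exact mul_nonneg (mul_nonneg (hp1 k) (hp0 k)) (sq_nonneg _)
    · refine (hce k).lt_of_ne' fun h0 => ?_
      simp [h0] at hk
  · simp_rw [hatom] at hp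
    have hp0 : ∀ k, 0 ≤ p k := fun k => by
      obtain ⟨η, hη⟩ := (hp k).2
      linarith [hη.trans measureReal_le_one]
    refine bennett_tail_le hR hf hK hdet hΓ hB' (hinc.mono hf hK fun k g hgm hgK hg => ⟨?_, ?_⟩)
      hce (fun k => mul_nonneg (hp0 k) (sq_nonneg _)) (fun k hk => ?_) ht
    · exact .of_forall fun a => (le_abs_self _).trans (hg.1 a)
    · obtain ⟨η, hη⟩ := (hp k).2
      exact variance_le_of_atom hgm hgK hη (hg.2.2 (p k) η (hp k).1 hη)
    · refine (hce k).lt_of_ne' fun h0 => ?_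
      have h1 : c k = 0 := by linarith [hc k, he k]
      have h2 : e k = 0 := by linarith [hc k, he k]
      simp [h1, h2] at hk

end Law

/-! ### Truncation by conditioning on a box -/

section Truncation

variable {N : ℕ} {Λ : Fin N → Type*} [∀ k, MeasurableSpace (Λ k)]
  {Γ B : Set (∀ k, Λ k)} {f : (∀ k, Λ k) → ℝ} {K s t δ : ℝ} {G : ∀ k, Set (Λ k)}

lemma integral_cond_eq (ν : ∀ k, Measure (Λ k)) (A : Set (∀ k, Λ k)) :
    ∫ x, f x ∂(Measure.pi ν)[|A] =
      ((Measure.pi ν).real A)⁻¹ * ∫ x in A, f x ∂Measure.pi ν := by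
  rw [ProbabilityTheory.cond, integral_smul_measure, ENNReal.toReal_inv, smul_eq_mul]
  rfl

variable {ν : ∀ k, Measure (Λ k)} [∀ k, IsProbabilityMeasure (ν k)]

lemma pi_cond (hG : ∀ k, MeasurableSet (G k)) :
    (Measure.pi ν)[|Set.univ.pi G] = Measure.pi fun k => (ν k)[|G k] := by
  refine (Measure.pi_eq fun s _ => ?_).symm
  rw [cond_apply (.univ_pi hG), ← Set.pi_inter_distrib, Measure.pi_pi, Measure.pi_pi,
    ENNReal.prod_inv_distrib (fun i _ j _ _ => .inr (measure_ne_top _ _)),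
    ← Finset.prod_mul_distrib]
  exact Finset.prod_congr rfl fun k _ => (cond_apply (hG k) _ _).symm

lemma real_le_cond_real {A E : Set (∀ k, Λ k)} (hA : MeasurableSet A) (hEA : E ⊆ A) :
    (Measure.pi ν).real E ≤ ((Measure.pi ν)[|A]).real E := by
  refine ENNReal.toReal_mono (measure_ne_top _ _) ?_
  rw [cond_apply hA, Set.inter_eq_right.2 hEA]
  exact le_mul_of_one_le_left zero_le (ENNReal.one_le_inv.2 prob_le_one)

lemma condBad_eq_measureReal (hΓ : MeasurableSet Γ) (S : Finset (Fin N)) (x : ∀ k, Λ k) :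
    condBad ν Γ S x = 1 - (Measure.pi ν).real {y | S.piecewise x y ∈ Γ} := by
  have hm : MeasurableSet {y | S.piecewise x y ∈ Γ} :=
    ((measurable_piecewise_pair S).comp measurable_prodMk_left) hΓ
  rw [← probReal_compl_eq_one_sub hm]
  unfold condBad condMean
  rw [← integral_indicator_one hm.compl]
  rfl

/-- Conditioning on a box which contains `Γ` makes `Γ` more likely, given values in the box. -/
lemma condBad_cond_le (hG : ∀ k, MeasurableSet (G k)) (hG0 : ∀ k, ν k (G k) ≠ 0)
    (hΓ : MeasurableSet Γ) (hΓG : Γ ⊆ Set.univ.pi G) (S : Finset (Fin N)) (x : ∀ k, Λ k) :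
    condBad (fun k => (ν k)[|G k]) Γ S x ≤ condBad ν Γ S x := by
  have hprob : ∀ k, IsProbabilityMeasure ((ν k)[|G k]) := fun k =>
    cond_isProbabilityMeasure (hG0 k)
  rw [condBad_eq_measureReal hΓ, condBad_eq_measureReal hΓ, ← pi_cond hG]
  refine sub_le_sub_left (ENNReal.toReal_mono (measure_ne_top _ _) ?_) _
  set U := Set.univ.pi G with hU
  have hUm : MeasurableSet U := .univ_pi hG
  set A := {y : ∀ k, Λ k | S.piecewise x y ∈ Γ} with hA
  have hAm : MeasurableSet A := ((measurable_piecewise_pair S).comp measurable_prodMk_left) hΓ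
  let C : Set (∀ k, Λ k) := {y | ∀ k ∈ S, y k ∈ G k}
  have hUC : Measure.pi ν U ≤ Measure.pi ν C := measure_mono fun y hy k _ => hy k trivial
  -- As `Γ` lies in the box, `A` already forces the coordinates outside `S` into it. The box thus
  -- constrains only the coordinates in `S`, which are independent of `A`, and `U ∩ A` has measure
  -- `π(C) π(A) ≥ π(U) π(A)` for the product measure `π`.
  have hpre : (fun p : (∀ j, Λ j) × (∀ j, Λ j) => S.piecewise p.1 p.2) ⁻¹' (U ∩ A) = C ×ˢ A := by
    ext ⟨u, w⟩
    have hw : S.piecewise x (S.piecewise u w) = S.piecewise x w := Finset.piecewise_idem_right ..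
    simp only [hA, Set.mem_preimage, Set.mem_inter_iff, Set.mem_prod, Set.mem_ofPred_eq, hw, C]
    refine and_congr_left fun hwΓ => ⟨fun h k hk => ?_, fun h k _ => ?_⟩
    · simpa [hk] using h k trivial
    · by_cases hk : k ∈ S
      · simpa [hk] using h k hk
      · simpa [hk] using hΓG hwΓ k trivial
  rw [cond_apply hUm, ← (measurePreserving_piecewise ν S).measure_preimage
    (hUm.inter hAm).nullMeasurableSet, hpre, Measure.prod_prod, ← mul_assoc]
  refine le_mul_of_one_le_left zero_le ?_
  have hU0 : Measure.pi ν U ≠ 0 := by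
    rw [hU, Measure.pi_pi]; exact Finset.prod_ne_zero_iff.2 fun k _ => hG0 k
  rw [← ENNReal.inv_mul_cancel hU0 (measure_ne_top _ _)]
  exact mul_le_mul_right hUC _

/-- The supremum `M` of `h` on `A` separates the values on `A` from those off `A`, so the average
over `A` cannot exceed the overall one. -/
lemma setIntegral_le_of_le_off {α : Type*} [MeasurableSpace α] {ρ : Measure α}
    [IsProbabilityMeasure ρ] {h : α → ℝ} (hh : Measurable h) (hK : ∀ a, |h a| ≤ K) {A : Set α}
    (hA : MeasurableSet A) (hle : ∀ a ∈ A, ∀ b ∉ A, h a ≤ h b) :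
    ∫ a in A, h a ∂ρ ≤ ρ.real A * ∫ a, h a ∂ρ := by
  rcases A.eq_empty_or_nonempty with rfl | hne
  · simp
  have hi : Integrable h ρ := integrable_of_abs_le hh hK
  have hbdd : BddAbove (h '' A) := ⟨K, by rintro _ ⟨a, -, rfl⟩; exact (abs_le.1 (hK a)).2⟩
  set M := sSup (h '' A)
  have h1 : ∫ a in A, h a ∂ρ ≤ ρ.real A * M := by
    have := setIntegral_mono_on hi.integrableOn (integrable_const M).integrableOn hA
      fun a ha => le_csSup hbdd ⟨a, ha, rfl⟩
    simpa using this
  have h2 : ρ.real Aᶜ * M ≤ ∫ a in Aᶜ, h a ∂ρ := by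
    have := setIntegral_mono_on (integrable_const M).integrableOn hi.integrableOn hA.compl
      fun b hb => csSup_le (hne.image h) (by rintro _ ⟨a, ha, rfl⟩; exact hle a ha b hb)
    simpa using this
  rw [probReal_compl_eq_one_sub hA] at h2
  rw [← integral_add_compl hA hi]
  have hp0 : 0 ≤ ρ.real A := measureReal_nonneg
  have hp1 : ρ.real A ≤ 1 := measureReal_le_one
  nlinarith [mul_le_mul_of_nonneg_left h2 hp0, mul_le_mul_of_nonneg_left h1 (sub_nonneg.2 hp1)]

/-- The coordinates of the box are imposed one at a time: the new one is resampled, and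
`setIntegral_le_of_le_off` is applied along each fibre. -/
lemma setIntegral_pi_le_of_truncationDecreases (hf : Measurable f) (hK : ∀ x, |f x| ≤ K)
    (hG : ∀ k, MeasurableSet (G k)) (hdec : TruncationDecreases G f) (S : Finset (Fin N)) :
    ∫ x in {x | ∀ k ∈ S, x k ∈ G k}, f x ∂Measure.pi ν ≤
      (∏ k ∈ S, (ν k).real (G k)) * ∫ x, f x ∂Measure.pi ν := by
  have hC : ∀ S : Finset (Fin N), MeasurableSet {x : ∀ k, Λ k | ∀ k ∈ S, x k ∈ G k} := fun S => by
    have : {x : ∀ k, Λ k | ∀ k ∈ S, x k ∈ G k} = (S : Set (Fin N)).pi G := by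
      ext; simp [Set.mem_pi]
    rw [this]
    exact .pi S.countable_toSet fun k _ => hG k
  have hind : ∀ (A : Set (∀ k, Λ k)) x, |A.indicator f x| ≤ K := fun A x => by
    by_cases h : x ∈ A
    · simpa [h] using hK x
    · simpa [h] using (abs_nonneg _).trans (hK x)
  induction S using Finset.induction_on with
  | empty => simp
  | insert k S hk ih =>
    rw [Finset.prod_insert hk, mul_assoc]
    refine le_trans ?_ (mul_le_mul_of_nonneg_left ih measureReal_nonneg)
    rw [← integral_indicator (hC _), ← integral_indicator (hC _),
      integral_pi_update ν k (hf.indicator (hC _)) (hind _),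
      integral_pi_update ν k (hf.indicator (hC S)) (hind _), ← integral_const_mul]
    have hmem : ∀ (x : ∀ j, Λ j) a, (∀ j ∈ S, Function.update x k a j ∈ G j) ↔
        ∀ j ∈ S, x j ∈ G j := fun x a => by
      refine forall₂_congr fun j hj => ?_
      rw [Function.update_of_ne (ne_of_mem_of_not_mem hj hk)]
    have hmu : ∀ A, MeasurableSet A → Measurable fun p : (∀ j, Λ j) × Λ k =>
        A.indicator f (Function.update p.1 k p.2) := fun A hA =>
      (hf.indicator hA).comp (measurable_update_pair k)
    have hint : ∀ A, MeasurableSet A → Integrable (fun x => ∫ a, A.indicator f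
        (Function.update x k a) ∂ν k) (Measure.pi ν) := fun A hA =>
      integrable_of_abs_le (StronglyMeasurable.integral_prod_right (ν := ν k)
        (f := fun x a => A.indicator f (Function.update x k a))
        (hmu A hA).stronglyMeasurable).measurable
        fun x => abs_integral_le_of_abs_le _ fun a => hind A _
    refine integral_mono (hint _ (hC _)) ((hint _ (hC S)).const_mul _) fun x => ?_
    by_cases hx : ∀ j ∈ S, x j ∈ G j
    · have e1 : ∀ a, {x : ∀ k, Λ k | ∀ j ∈ insert k S, x j ∈ G j}.indicator f
          (Function.update x k a) = (G k).indicator (fun a => f (Function.update x k a)) a :=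
        fun a => by
          have : Function.update x k a ∈ {x : ∀ k, Λ k | ∀ j ∈ insert k S, x j ∈ G j} ↔ a ∈ G k := by
            simp only [Set.mem_ofPred_eq, Finset.forall_mem_insert, hmem, Function.update_self]
            exact and_iff_left hx
          by_cases ha : a ∈ G k
          · rw [Set.indicator_of_mem (this.2 ha), Set.indicator_of_mem ha]
          · rw [Set.indicator_of_notMem (mt this.1 ha), Set.indicator_of_notMem ha]
      have e2 : ∀ a, {x : ∀ k, Λ k | ∀ j ∈ S, x j ∈ G j}.indicator f
          (Function.update x k a) = f (Function.update x k a) := fun a =>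
        Set.indicator_of_mem (s := {x : ∀ k, Λ k | ∀ j ∈ S, x j ∈ G j}) ((hmem x a).2 hx) f
      simp only [e1, e2]
      rw [integral_indicator (hG k)]
      exact setIntegral_le_of_le_off
        (hf.comp ((measurable_update_pair k).comp measurable_prodMk_left)) (fun a => hK _) (hG k)
        fun a ha b hb => hdec k _ _ (differOnlyAt_update x k b a) (by simpa using hb)
          (by simpa using ha)
    · have e1 : ∀ a, {x : ∀ k, Λ k | ∀ j ∈ insert k S, x j ∈ G j}.indicator f
          (Function.update x k a) = 0 := fun a => by
        refine Set.indicator_of_notMem (fun h => hx ((hmem x a).1 fun j hj => ?_)) f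
        exact h j (Finset.mem_insert_of_mem hj)
      have e2 : ∀ a, {x : ∀ k, Λ k | ∀ j ∈ S, x j ∈ G j}.indicator f
          (Function.update x k a) = 0 := fun a =>
        Set.indicator_of_notMem (s := {x : ∀ k, Λ k | ∀ j ∈ S, x j ∈ G j})
          (fun h => hx ((hmem x a).1 h)) f
      simp only [e1, e2]
      simp

lemma integral_cond_le_of_truncationDecreases (hf : Measurable f) (hK : ∀ x, |f x| ≤ K)
    (hG : ∀ k, MeasurableSet (G k)) (hG0 : Measure.pi ν (Set.univ.pi G) ≠ 0)
    (hdec : TruncationDecreases G f) :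
    ∫ x, f x ∂(Measure.pi ν)[|Set.univ.pi G] ≤ ∫ x, f x ∂Measure.pi ν := by
  have hpos : 0 < (Measure.pi ν).real (Set.univ.pi G) :=
    ENNReal.toReal_pos hG0 (measure_ne_top _ _)
  rw [integral_cond_eq, inv_mul_le_iff₀ hpos]
  have h := setIntegral_pi_le_of_truncationDecreases (ν := ν) hf hK hG hdec Finset.univ
  have h1 : {x : ∀ k, Λ k | ∀ k ∈ Finset.univ, x k ∈ G k} = Set.univ.pi G := by
    ext; simp
  have h2 : (Measure.pi ν).real (Set.univ.pi G) = ∏ k, (ν k).real (G k) := by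
    simp [Measure.real, Measure.pi_pi, ENNReal.toReal_prod]
  rwa [h1, ← h2] at h

/-- No value of `f` lies more than `s` below its mean `I` over `A`. So the part off `A` lowers the
overall mean by at most `s` times the measure of `Aᶜ`, and `Aᶜ ⊆ Γᶜ`. -/
lemma integral_cond_le_add (hf : Measurable f) (hK : ∀ x, |f x| ≤ K) {A : Set (∀ k, Λ k)}
    (hA : MeasurableSet A) (hA0 : Measure.pi ν A ≠ 0) (hs : ∀ x y, |f x - f y| ≤ s)
    (hΓA : Γ ⊆ A) :
    ∫ x, f x ∂(Measure.pi ν)[|A] ≤ ∫ x, f x ∂Measure.pi ν + s * (Measure.pi ν).real Γᶜ := by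
  have hprob : IsProbabilityMeasure ((Measure.pi ν)[|A]) := cond_isProbabilityMeasure hA0
  have hpos : 0 < (Measure.pi ν).real A := ENNReal.toReal_pos hA0 (measure_ne_top _ _)
  have hi : Integrable f (Measure.pi ν) := integrable_of_abs_le hf hK
  set I := ∫ x, f x ∂(Measure.pi ν)[|A] with hI
  have hfI : ∀ x, I - s ≤ f x := fun x => by
    have : ∫ y, f y ∂(Measure.pi ν)[|A] ≤ ∫ _, (f x + s) ∂(Measure.pi ν)[|A] :=
      integral_mono (integrable_of_abs_le hf hK) (integrable_const _) fun y => by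
        linarith [(abs_le.1 (hs x y)).1]
    simp only [integral_const, probReal_univ, smul_eq_mul, one_mul] at this
    linarith
  have hs0 : 0 ≤ s := by
    obtain ⟨x, -⟩ := nonempty_of_measure_ne_zero hA0
    exact (abs_nonneg _).trans (hs x x)
  have h1 : ∫ x in A, f x ∂Measure.pi ν = (Measure.pi ν).real A * I := by
    rw [hI, integral_cond_eq, mul_inv_cancel_left₀ hpos.ne']
  have h2 : (Measure.pi ν).real Aᶜ * (I - s) ≤ ∫ x in Aᶜ, f x ∂Measure.pi ν := by
    have := setIntegral_mono_on (integrable_const (I - s)).integrableOn hi.integrableOn hA.compl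
      fun x _ => hfI x
    simpa using this
  have h3 : (Measure.pi ν).real Aᶜ ≤ (Measure.pi ν).real Γᶜ :=
    measureReal_mono (Set.compl_subset_compl.2 hΓA)
  rw [← integral_add_compl hA hi, h1]
  have h4 := probReal_compl_eq_one_sub (μ := Measure.pi ν) hA
  rw [h4] at h2 h3
  nlinarith [mul_le_mul_of_nonneg_left h3 hs0]

/-- A tail bound for the law conditioned on a box yields one for the original law. -/
lemma tail_le_of_cond_tail_le (hf : Measurable f) (hK : ∀ x, |f x| ≤ K)
    (hG : ∀ k, MeasurableSet (G k)) (hΓG : Γ ⊆ Set.univ.pi G) (hBG : Bᶜ ⊆ Set.univ.pi G)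
    (hs : ∀ x y, |f x - f y| ≤ s)
    (hδ : δ = s * (Measure.pi ν).real Γᶜ ∨ (δ = 0 ∧ TruncationDecreases G f)) {R : ℝ} (hR : 0 ≤ R)
    (h : (∀ k, ν k (G k) ≠ 0) → (Measure.pi fun k => (ν k)[|G k]).real
      {x | ∫ y, f y ∂(Measure.pi fun k => (ν k)[|G k]) + t ≤ f x ∧ x ∉ B} ≤ R) :
    (Measure.pi ν).real {x | ∫ y, f y ∂Measure.pi ν + (t + δ) ≤ f x ∧ x ∉ B} ≤ R := by
  by_cases hG0 : ∀ k, ν k (G k) ≠ 0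
  · have hU0 : Measure.pi ν (Set.univ.pi G) ≠ 0 := by
      rw [Measure.pi_pi]; exact Finset.prod_ne_zero_iff.2 fun k _ => hG0 k
    have hprob : IsProbabilityMeasure ((Measure.pi ν)[|Set.univ.pi G]) :=
      cond_isProbabilityMeasure hU0
    refine le_trans ?_ (h hG0)
    rw [← pi_cond hG]
    refine (real_le_cond_real (.univ_pi hG) fun x hx => hBG hx.2).trans (measureReal_mono ?_)
    refine fun x hx => ⟨?_, hx.2⟩
    have hx1 := hx.1
    rcases hδ with rfl | ⟨rfl, hdec⟩
    · linarith [integral_cond_le_add (ν := ν) hf hK (.univ_pi hG) hU0 hs hΓG]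
    · linarith [integral_cond_le_of_truncationDecreases hf hK hG hU0 hdec]
  · push Not at hG0
    obtain ⟨k, hk⟩ := hG0
    have hU0 : Measure.pi ν (Set.univ.pi G) = 0 := by
      rw [Measure.pi_pi]; exact Finset.prod_eq_zero (Finset.mem_univ k) hk
    have : Measure.pi ν {x | ∫ y, f y ∂Measure.pi ν + (t + δ) ≤ f x ∧ x ∉ B} = 0 :=
      measure_mono_null (fun x hx => hBG hx.2) hU0
    rw [Measure.real, this]
    exact hR

end Truncation

/-! ### The tail inequalities -/

section Main

variable {N : ℕ} {Λ : Fin N → Type*} [∀ k, MeasurableSpace (Λ k)] {σ τ : QueryStrategy Λ}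

/-- With `Γ = univ` failure is impossible, so even `γ = 0` makes every step good. The inequalities
without a bad event thus use the same machinery. -/
lemma mem_goodAt_univ {ν : ∀ k, Measure (Λ k)} (i : ℕ) (x : ∀ k, Λ k) :
    x ∈ goodAt ν τ Set.univ (fun _ => 0) i := fun _ => by
  simp [condBad, condMean]

lemma incrementsSatisfy_of_lipschitz {ν : ∀ k, Measure (Λ k)} [∀ k, IsProbabilityMeasure (ν k)]
    {f : (∀ k, Λ k) → ℝ} {K : ℝ} {G : ∀ k, Set (Λ k)} {c : Fin N → ℝ}
    (hf : Measurable f) (hK : ∀ x, |f x| ≤ K) (hG : ∀ k, ∀ᵐ a ∂ν k, a ∈ G k)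
    (hL : LipschitzOnSet (Set.univ.pi G) f c) :
    IncrementsSatisfy ν τ Set.univ (fun _ => 0) f
      fun k g => ∀ a ∈ G k, ∀ b ∈ G k, |g a - g b| ≤ c k := by
  -- With `d = c` the term involving the failure probability disappears.
  refine (incrementsSatisfy_of_typical (c := c) (d := c) hf hK .univ hG ⟨fun _ => le_rfl,
    fun k x hx y hy h => ⟨fun _ => hL k x hx y hy h, fun _ => hL k x hx y hy h⟩⟩).mono hf hK ?_
  rintro k g _ _ ⟨φ, _, _, _, h⟩ a ha b hb
  simpa using h a ha b hb

variable [∀ k, MeasurableSingletonClass (Λ k)] {Ω : Type*} [MeasurableSpace Ω]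
  {P : Measure Ω} [IsProbabilityMeasure P] {X : ∀ k, Ω → Λ k}

/-- The tail bounds hold off every event `B` whose complement lies in `Γ` and consists of outcomes
for which `Γ` is likely in all steps of the exposure. -/
theorem typicalTails_of_good {Γ B : Set (∀ k, Λ k)} {γ : Fin N → ℝ}
    (hX : ∀ k, Measurable (X k)) (hind : iIndepFun X P) (hR : QueryStrategy.Refines σ τ)
    (hΓ : MeasurableSet Γ) (hγ : ∀ k, 0 ≤ γ k) (hBm : MeasurableSet B) (hBΓ : Bᶜ ⊆ Γ)
    (hB : ∀ x ∉ B, ∀ i, x ∈ goodAt (fun k => P.map (X k)) τ Γ γ i) :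
    TypicalTails P X σ Γ γ B := by
  have hprob : ∀ k, IsProbabilityMeasure (P.map (X k)) := fun k =>
    Measure.isProbabilityMeasure_map (hX k).aemeasurable
  intro f hf hdet c d
  refine ⟨fun hTL => ?_, fun hTL q hq => ?_, fun G hG hΓG hTL s hs δ hδ t ht => ?_⟩
  -- If `B` is everything the tail is `0`. Otherwise a point off `B` lies in `Γ`, and comparing it
  -- with itself gives `0 ≤ c k`.
  · by_cases hall : ∀ x, x ∈ B
    · exact tailsOff_of_forall_mem hall
    push Not at hall
    obtain ⟨z, hz⟩ := hall
    have hc : ∀ k, 0 ≤ c k := fun k =>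
      (abs_nonneg _).trans ((hTL.2 k z trivial z trivial fun _ _ => rfl).1 (hBΓ hz))
    obtain ⟨K, hK⟩ := exists_abs_le_of_differences (abs_sub_le_sum_of_differences
      fun k x y hxy => show |f x - f y| ≤ d k by
        by_cases hx : x ∈ Γ
        · exact ((hTL.2 k x trivial y trivial hxy).1 hx).trans (hTL.1 k)
        · exact (hTL.2 k x trivial y trivial hxy).2 hx)
    refine tailsOff_of_controlled hX hind hR hf hK hdet hΓ hBm hB ?_ hc fun k =>
      mul_nonneg (hγ k) (sub_nonneg.2 (hTL.1 k))
    refine (incrementsSatisfy_of_typical (G := fun _ => Set.univ) hf hK hΓ (by simp)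
      (by simpa using hTL)).mono hf hK fun k g hg hgK h => ?_
    exact h.controlled hg hgK (hTL.1 k)
  · by_cases hall : ∀ x, x ∈ B
    · exact tailsOff_of_forall_mem hall
    push Not at hall
    obtain ⟨z, hz⟩ := hall
    have hc : ∀ k, 0 ≤ c k := fun k =>
      (abs_nonneg _).trans ((hTL.2 k z z fun _ _ => rfl).1 ⟨hBΓ hz, hBΓ hz⟩)
    obtain ⟨K, hK⟩ := exists_abs_le_of_differences (abs_sub_le_sum_of_differences
      fun k x y hxy => show |f x - f y| ≤ d k by
        by_cases hx : x ∈ Γ ∧ y ∈ Γ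
        · exact ((hTL.2 k x y hxy).1 hx).trans (hTL.1 k)
        · exact (hTL.2 k x y hxy).2 hx)
    have hq' : ∀ k, 0 < q k ∧ ∀ η, q k ≤ (P.map (X k)).real {η} := fun k =>
      ⟨(hq k).1, fun η => by
        rw [map_measureReal_apply (hX k) (measurableSet_singleton η)]; exact (hq k).2 η⟩
    refine tailsOff_of_controlled hX hind hR hf hK hdet hΓ hBm hB
      (incrementsSatisfy_of_twoSided hf hK hΓ hTL hγ hq') hc fun k => ?_
    exact mul_nonneg (mul_nonneg (mul_nonneg two_pos.le (hγ k)) (sub_nonneg.2 (hTL.1 k)))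
      (inv_nonneg.2 (hq k).1.le)
  · obtain ⟨K, hK⟩ := exists_abs_le_of_differences hs
    rw [tailOff_eq hX hind hf hBm]
    unfold IsTruncationError at hδ
    rw [probIn_eq hX hind hΓ.compl] at hδ
    refine tail_le_of_cond_tail_le hf hK hG hΓG (hBΓ.trans hΓG) hs hδ (expNegDiv_nonneg _ _)
      fun hG0 => ?_
    have hprob' : ∀ k, IsProbabilityMeasure ((P.map (X k))[|G k]) := fun k =>
      cond_isProbabilityMeasure (hG0 k)
    have hGae : ∀ k, ∀ᵐ a ∂(P.map (X k))[|G k], a ∈ G k := fun k => ae_cond_mem (hG k)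
    refine azuma_tail_le (γ := γ) hR hf hK hdet hΓ (.of_forall fun x hx i hk => ?_)
      ((incrementsSatisfy_of_typical hf hK hΓ hGae hTL).mono hf hK fun k g hg hgK h => ?_) ht
    -- Goodness was assumed for the original law; it passes to the conditioned law, which makes
    -- failure less likely.
    · exact (condBad_cond_le hG hG0 hΓ hΓG _ x).trans (hB x hx i hk)
    · filter_upwards [hGae k] with a ha
      exact h.abs_sub_integral_le hg hgK (hGae k) (hTL.1 k) ha

/-- The bounded differences inequalities for a dynamic exposure. -/
theorem boundedDifferencesTails (hX : ∀ k, Measurable (X k)) (hind : iIndepFun X P)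
    (σ : QueryStrategy Λ) : BoundedDifferencesTails P X σ := by
  have hprob : ∀ k, IsProbabilityMeasure (P.map (X k)) := fun k =>
    Measure.isProbabilityMeasure_map (hX k).aemeasurable
  obtain ⟨ω₀⟩ : Nonempty Ω := nonempty_of_isProbabilityMeasure P
  have hR := σ.refines_self
  have hint : ∀ {k : Fin N} {ρ : Measure (Λ k)} [IsProbabilityMeasure ρ] {A : Set (Λ k)}
      {g : Λ k → ℝ} {r : ℝ}, (∀ᵐ a ∂ρ, a ∈ A) → (∀ a ∈ A, ∀ b ∈ A, |g a - g b| ≤ r) →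
      ∃ l, ∀ᵐ a ∂ρ, g a ∈ Set.Icc l (l + r) := fun hA h => by
    obtain ⟨l, hl⟩ := exists_interval_of_abs_sub_le hA.exists h
    exact ⟨l, hA.mono hl⟩
  intro f hf hdet c t ht
  refine ⟨fun hL => ?_, fun G hG hL s hs δ hδ => ?_⟩
  · have hc : ∀ k, 0 ≤ c k := fun k => (abs_nonneg _).trans
      (hL k (fun j => X j ω₀) trivial (fun j => X j ω₀) trivial fun _ _ => rfl)
    obtain ⟨K, hK⟩ := exists_abs_le_of_differences (abs_sub_le_sum_of_differences
      fun k x y => hL k x trivial y trivial)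
    have hB : ∀ x ∉ (∅ : Set (∀ k, Λ k)), ∀ i, x ∈ goodAt (fun k => P.map (X k)) σ Set.univ
      (fun _ => 0) i := fun x _ i => mem_goodAt_univ i x
    have hinc := incrementsSatisfy_of_lipschitz (ν := fun k => P.map (X k)) (τ := σ)
      (G := fun _ => Set.univ) hf hK (by simp) (by simpa using hL)
    rw [tail_eq_tailOff]
    refine ⟨?_, fun one hcard p hp => ?_, fun p hp => ?_⟩
    · rw [tailOff_eq hX hind hf .empty]
      exact hoeffding_tail_le hR hf hK hdet .univ (.of_forall hB)
        (hinc.mono hf hK fun k g _ _ hg => hint (by simp) hg) ht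
    · have h := tailsOff_of_controlled (e := 0) hX hind hR hf hK hdet .univ .empty hB
        (hinc.mono hf hK fun k g hg hgK h => controlledIncrement_of_abs_sub_le hg hgK le_rfl
          fun a b => by simpa using h a trivial b trivial) hc fun _ => le_rfl
      simpa using (h t ht).2.2.1 one hcard p hp
    -- Here `p k ≥ 1` is allowed, so the clause of `ControlledIncrement` containing `(1 - p)⁻¹` is
    -- not available, and the variance is bounded directly.
    · have hp' : ∀ k, ∃ η, 1 - p k ≤ (P.map (X k)).real {η} := fun k => by
        obtain ⟨η, hη⟩ := hp k
        exact ⟨η, by rwa [map_measureReal_apply (hX k) (measurableSet_singleton η)]⟩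
      have hp0 : ∀ k, 0 ≤ p k := fun k => by
        obtain ⟨η, hη⟩ := hp k
        linarith [hη.trans measureReal_le_one]
      rw [tailOff_eq hX hind hf .empty]
      refine bennett_tail_le hR hf hK hdet .univ (.of_forall hB)
        (hinc.mono hf hK fun k g hg hgK h => ⟨.of_forall fun a => ?_, ?_⟩) hc
        (fun k => mul_nonneg (hp0 k) (sq_nonneg _)) (fun k hk => (hc k).lt_of_ne' ?_) ht
      · have := (controlledIncrement_of_abs_sub_le (ν := fun k => P.map (X k)) (c := c) (e := 0)
          hg hgK le_rfl fun a b => by simpa using h a trivial b trivial).1 a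
        simpa using (le_abs_self _).trans this
      · obtain ⟨η, hη⟩ := hp' k
        exact variance_le_of_atom hg hgK hη fun a => h a trivial η trivial
      · rintro h0
        simp [h0] at hk
  · obtain ⟨K, hK⟩ := exists_abs_le_of_differences hs
    have hU : MeasurableSet (Set.univ.pi G) := .univ_pi hG
    rw [tailOff_eq hX hind hf hU.compl]
    unfold IsTruncationError at hδ
    rw [probIn_eq hX hind hU.compl] at hδ
    refine tail_le_of_cond_tail_le hf hK hG le_rfl (by simp) hs hδ (expNegDiv_nonneg _ _)
      fun hG0 => ?_
    have hprob' : ∀ k, IsProbabilityMeasure ((P.map (X k))[|G k]) := fun k =>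
      cond_isProbabilityMeasure (hG0 k)
    have hGae : ∀ k, ∀ᵐ a ∂(P.map (X k))[|G k], a ∈ G k := fun k => ae_cond_mem (hG k)
    refine (hoeffding_tail_le hR hf hK hdet .univ (.of_forall fun x _ i => mem_goodAt_univ i x)
      ((incrementsSatisfy_of_lipschitz hf hK hGae hL).mono hf hK fun k g _ _ hg =>
        hint (hGae k) hg) ht).trans_eq ?_
    rw [← expNegDiv_mul_left two_ne_zero]
    congr 1
    ring

end Main

/-! ### The probability of the bad event -/

section BadEvent

variable {N : ℕ} {Λ : Fin N → Type*} [∀ k, MeasurableSpace (Λ k)]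

/-- The event that `Γ` fails, or becomes unlikely during the exposure by `τ`. -/
def badEvent (ν : ∀ k, Measure (Λ k)) (τ : QueryStrategy Λ) (Γ : Set (∀ k, Λ k))
    (γ : Fin N → ℝ) : Set (∀ k, Λ k) :=
  Γᶜ ∪ ⋃ i, (goodAt ν τ Γ γ i)ᶜ

variable {ν : ∀ k, Measure (Λ k)} {τ : QueryStrategy Λ} {Γ : Set (∀ k, Λ k)} {γ : Fin N → ℝ}

lemma notMem_badEvent {x : ∀ k, Λ k} :
    x ∉ badEvent ν τ Γ γ ↔ x ∈ Γ ∧ ∀ i, x ∈ goodAt ν τ Γ γ i := by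
  simp [badEvent]

variable [∀ k, IsProbabilityMeasure (ν k)]

lemma measurableSet_badEvent (hΓ : MeasurableSet Γ) : MeasurableSet (badEvent ν τ Γ γ) :=
  hΓ.compl.union (.iUnion fun i => (measurableSet_goodAt ν hΓ i).compl)

/-- Markov's inequality for the conditional failure probability, whose mean is the failure
probability by the tower property. -/
lemma measureReal_compl_goodAt_le (hΓ : MeasurableSet Γ) {i : ℕ} {b : ℝ} (hb : 0 < b)
    (hbγ : ∀ x, b ≤ γ (τ.query i x)) :
    (Measure.pi ν).real (goodAt ν τ Γ γ i)ᶜ ≤ b⁻¹ * (Measure.pi ν).real Γᶜ := by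
  have hm : Measurable (Γᶜ.indicator fun _ => (1 : ℝ)) := measurable_const.indicator hΓ.compl
  have hmean : ∫ x, condBad ν Γ (τ.exposed i x) x ∂Measure.pi ν = (Measure.pi ν).real Γᶜ := by
    refine (integral_condMean_random ν hm (abs_indicator_one_le _) (τ.exposed i)
      (fun s => τ.measurable_exposed i (measurableSet_singleton s))
      fun x y h => QueryStrategy.exposed_congr h (Nat.le_succ i)).trans ?_
    exact integral_indicator_one hΓ.compl
  have hcm : Measurable fun x => condBad ν Γ (τ.exposed i x) x :=
    measurable_apply_finset (τ.measurable_exposed i) fun s => measurable_condMean ν hm s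
  have hmarkov := mul_meas_ge_le_integral_of_nonneg (μ := Measure.pi ν)
    (f := fun x => condBad ν Γ (τ.exposed i x) x)
    (.of_forall fun x => integral_nonneg fun y =>
      Set.indicator_nonneg (fun _ _ => zero_le_one) _)
    (integrable_of_abs_le hcm fun x => abs_condMean_le ν (abs_indicator_one_le _) _ _) b
  rw [hmean] at hmarkov
  rw [← div_eq_inv_mul, le_div_iff₀ hb, mul_comm]
  refine le_trans (mul_le_mul_of_nonneg_left (measureReal_mono fun x hx => ?_) hb.le) hmarkov
  simp only [goodAt, Set.mem_compl_iff, Set.mem_ofPred_eq, Classical.not_imp, not_le] at hx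
  exact (hbγ x).trans hx.2.le

/-- The union bound for the bad event. -/
lemma measureReal_badEvent_le (hΓ : MeasurableSet Γ) {m : ℕ} (hm : 0 < m)
    (hstale : ∀ i ≥ m, ∀ x, τ.query i x ∈ τ.exposed i x) {b : ℕ → ℝ}
    (hb : ∀ i, 0 < b i ∧ b i ≤ 1) (hbγ : ∀ i x, b i ≤ γ (τ.query i x)) :
    (Measure.pi ν).real (badEvent ν τ Γ γ) ≤
      (∑ i ∈ Finset.range m, (b i)⁻¹) * (Measure.pi ν).real Γᶜ := by
  obtain ⟨m, rfl⟩ : ∃ l, m = l + 1 := ⟨m - 1, by omega⟩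
  have hb0 : ∀ i, 0 ≤ (b i)⁻¹ := fun i => inv_nonneg.2 (hb i).1.le
  set p := (Measure.pi ν).real Γᶜ with hp
  have hp0 : 0 ≤ p := measureReal_nonneg
  rw [Finset.sum_range_succ', add_mul, Finset.sum_mul]
  -- The condition of step `0` involves no exposed value. If `p ≤ b 0` it always holds, and its term
  -- in the sum is free to pay for `Γᶜ`. Otherwise that term alone is at least `1`.
  by_cases hpb : p ≤ b 0
  · have hgood0 : ∀ x, x ∈ goodAt ν τ Γ γ 0 := fun x _ => by
      rw [QueryStrategy.exposed_zero, condBad, condMean_empty]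
      refine le_trans (le_of_eq ?_) (hpb.trans (hbγ 0 x))
      exact integral_indicator_one hΓ.compl
    have hsub : badEvent ν τ Γ γ ⊆
        (⋃ i ∈ Finset.range m, (goodAt ν τ Γ γ (i + 1))ᶜ) ∪ Γᶜ := by
      rintro x (hx | hx)
      · exact .inr hx
      · obtain ⟨i, hi⟩ := Set.mem_iUnion.1 hx
        rcases i with _ | i
        · exact absurd (hgood0 x) hi
        · refine .inl (Set.mem_biUnion (Finset.mem_coe.2 (Finset.mem_range.2 ?_)) hi)
          by_contra! h
          exact hi fun hfresh => absurd (hstale (i + 1) (by omega) x) hfresh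
    refine (measureReal_mono hsub).trans ((measureReal_union_le _ _).trans (add_le_add ?_ ?_))
    · refine (measureReal_biUnion_finset_le _ _).trans (Finset.sum_le_sum fun i _ => ?_)
      exact measureReal_compl_goodAt_le hΓ (hb _).1 (hbγ _)
    · exact le_mul_of_one_le_left hp0 ((one_le_inv₀ (hb 0).1).2 (hb 0).2)
  · push Not at hpb
    refine measureReal_le_one.trans ?_
    have h1 : 1 ≤ (b 0)⁻¹ * p := by
      rw [← div_eq_inv_mul, le_div_iff₀ (hb 0).1, one_mul]; exact hpb.le
    have h2 : 0 ≤ ∑ i ∈ Finset.range m, (b (i + 1))⁻¹ * p :=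
      Finset.sum_nonneg fun i _ => mul_nonneg (hb0 _) hp0
    linarith

lemma measureReal_badEvent_le_maxSum (σ : QueryStrategy Λ) (hΓ : MeasurableSet Γ) {g : ℝ}
    (hg : 0 < g) (hg1 : g ≤ 1) :
    (Measure.pi ν).real (badEvent ν σ Γ fun _ => g) ≤
      (σ.maxSum fun _ => g⁻¹) * (Measure.pi ν).real Γᶜ := by
  obtain ⟨z⟩ : Nonempty (∀ k, Λ k) := nonempty_of_isProbabilityMeasure (Measure.pi ν)
  obtain ⟨_, ⟨x₀, rfl⟩, hmax⟩ := Set.exists_max_image (Set.range σ.queried) Finset.card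
    (Set.toFinite _) ⟨_, z, rfl⟩
  -- Take for `m` the largest size of a query set: a fresh index in a step `i ≥ m` would produce a
  -- query set with more than `m` elements.
  refine (measureReal_badEvent_le (b := fun _ => g) hΓ
    (Finset.card_pos.2 (σ.queried_nonempty x₀)) (fun i hi x => ?_) (fun _ => ⟨hg, hg1⟩)
    fun _ _ => le_rfl).trans (mul_le_mul_of_nonneg_right ?_ measureReal_nonneg)
  · by_contra h
    have h1 := σ.card_exposed_succ h
    have h2 := Finset.card_le_card (σ.exposed_subset_queried (i + 1) x)
    have h3 := hmax _ ⟨x, rfl⟩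
    omega
  · refine le_trans (le_of_eq ?_) (σ.sum_queried_le_maxSum (fun _ => g⁻¹) x₀)
    simp

lemma measureReal_badEvent_natural_le (hN : 0 < N) (hΓ : MeasurableSet Γ)
    (hγ : ∀ k, 0 < γ k ∧ γ k ≤ 1) :
    (Measure.pi ν).real (badEvent ν (.natural hN) Γ γ) ≤
      (∑ k, (γ k)⁻¹) * (Measure.pi ν).real Γᶜ := by
  refine (measureReal_badEvent_le (b := fun i => γ ⟨min i (N - 1), by omega⟩) hΓ hN
    (fun i hi x => ?_) (fun i => hγ _) fun i x => le_rfl).trans_eq ?_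
  · by_contra h
    exact absurd (QueryStrategy.lt_of_natural_query_notMem hN h) (by omega)
  · rw [Finset.sum_range]
    congr 2
    ext k
    have : (⟨min (k : ℕ) (N - 1), by omega⟩ : Fin N) = k := Fin.ext (by simp only; omega)
    rw [this]

end BadEvent

/-! ### Positive correlation for monotone events -/

section Correlation

variable {N : ℕ} {Λ : Fin N → Type*} [∀ k, MeasurableSpace (Λ k)] {ν : ∀ k, Measure (Λ k)}
  [∀ k, IsProbabilityMeasure (ν k)] {one : ∀ k, Λ k}

lemma condBad_le_of_zeroOneLE {Γ : Set (∀ k, Λ k)} (hΓ : MeasurableSet Γ)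
    (hup : ∀ x y, ZeroOneLE one x y → x ∈ Γ → y ∈ Γ) {S : Finset (Fin N)} {x y : ∀ k, Λ k}
    (hxy : ZeroOneLE one x y) : condBad ν Γ S y ≤ condBad ν Γ S x := by
  rw [condBad_eq_measureReal hΓ, condBad_eq_measureReal hΓ]
  refine sub_le_sub_left (measureReal_mono (μ := Measure.pi ν)
    (s₁ := {w | S.piecewise x w ∈ Γ}) (s₂ := {w | S.piecewise y w ∈ Γ})
    fun w hw => hup (S.piecewise x w) (S.piecewise y w) (fun k hk => ?_) hw) _
  by_cases hS : k ∈ S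
  · simp only [hS, Finset.piecewise_eq_of_mem] at hk ⊢
    exact hxy k hk
  · simpa [hS] using hk

variable [∀ k, MeasurableSingletonClass (Λ k)]

/-- Harris's inequality for two increasing events of independent `0`-`1` variables. -/
lemma harris_le (hcard : ∀ k, Nat.card (Λ k) = 2) {A A' : Set (∀ k, Λ k)}
    (hA : ∀ x y, ZeroOneLE one x y → x ∈ A → y ∈ A)
    (hA' : ∀ x y, ZeroOneLE one x y → x ∈ A' → y ∈ A') :
    (Measure.pi ν).real A * (Measure.pi ν).real A' ≤ (Measure.pi ν).real (A ∩ A') := by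
  classical
  choose zero hne hall using fun k => exists_other_of_card_two (hcard k) (one k)
  let u : (Fin N → Bool) → ∀ k, Λ k := fun v k => if v k then one k else zero k
  have hu_one : ∀ v k, u v k = one k ↔ v k = true := fun v k => by
    by_cases h : v k <;> simp [u, h, hne]
  have hinj : Function.Injective u := fun v w h => by
    ext k
    rw [Bool.eq_iff_iff, ← hu_one, ← hu_one, h]
  have hsurj : Function.Surjective u := fun x => ⟨fun k => decide (x k = one k), by
    ext k
    rcases hall k (x k) with h | h
    · simp [u, h]
    · simp [u, h, hne]⟩
  have hsum : ∀ E : Set (∀ k, Λ k), (Measure.pi ν).real E =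
      ∑ v, (Measure.pi ν).real {u v} * (if u v ∈ E then 1 else 0) := fun E => by
    have hE : E = ⋃ v ∈ Finset.univ.filter (fun v => u v ∈ E), {u v} := by
      ext x
      obtain ⟨v, rfl⟩ := hsurj x
      simp [hinj.eq_iff]
    conv_lhs => rw [hE]
    rw [measureReal_biUnion_finset
      (fun v _ w _ hvw => Set.disjoint_singleton.2 (hinj.ne hvw))
      (fun v _ => measurableSet_singleton _), Finset.sum_filter]
    simp
  have hmono : ∀ E : Set (∀ k, Λ k), (∀ x y, ZeroOneLE one x y → x ∈ E → y ∈ E) →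
      Monotone fun v => if u v ∈ E then (1 : ℝ) else 0 := fun E hE v w hvw => by
    by_cases hv : u v ∈ E
    · have : u w ∈ E := hE _ _ (fun k hk => (hu_one w k).2
        (Bool.eq_true_of_true_le (((hu_one v k).1 hk) ▸ hvw k))) hv
      simp [hv, this]
    · simp only [hv, if_false]
      split_ifs <;> norm_num
  have hatom : ∀ v, (Measure.pi ν).real {u v} = ∏ k, (ν k).real {u v k} := fun v => by
    simp [Measure.real, Measure.pi_singleton, ENNReal.toReal_prod]
  -- Product weights on the Boolean cube satisfy the lattice condition with equality, as meet and
  -- join only rearrange the two values in each coordinate.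
  have h := fkg (μ := fun v => (Measure.pi ν).real {u v})
    (f := fun v => if u v ∈ A then (1 : ℝ) else 0) (g := fun v => if u v ∈ A' then (1 : ℝ) else 0)
    (fun _ => measureReal_nonneg) (fun v => by dsimp; split_ifs <;> norm_num)
    (fun v => by dsimp; split_ifs <;> norm_num) (hmono A hA) (hmono A' hA') fun v w => by
      simp only [hatom, ← Finset.prod_mul_distrib]
      refine le_of_eq (Finset.prod_congr rfl fun k _ => ?_)
      cases hv : v k <;> cases hw : w k <;> simp [u, hv, hw, mul_comm]
  have htot := hsum Set.univ
  simp only [probReal_univ, Set.mem_univ, if_true, mul_one] at htot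
  rw [← hsum, ← hsum, ← htot, one_mul] at h
  rw [hsum (A ∩ A')]
  refine h.trans_eq (Finset.sum_congr rfl fun v _ => ?_)
  by_cases h1 : u v ∈ A <;> by_cases h2 : u v ∈ A' <;> simp [h1, h2]

/-- The natural order exposes the same set for all outcomes, so the conditions of `goodAt` can be
compared between `x` and `y`. For increasing `Γ` each is increasing, and Harris's inequality applies
to the complement of the bad event. -/
lemma tail_mul_le_of_increasing (hN : 0 < N) (hcard : ∀ k, Nat.card (Λ k) = 2)
    {Γ : Set (∀ k, Λ k)} {γ : Fin N → ℝ} {f : (∀ k, Λ k) → ℝ} (hΓ : MeasurableSet Γ)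
    (hmono : ∀ x y, ZeroOneLE one x y → f x ≤ f y ∧ (x ∈ Γ → y ∈ Γ)) (s : ℝ) :
    (Measure.pi ν).real {x | s ≤ f x} *
        (Measure.pi ν).real (badEvent ν (.natural hN) Γ γ)ᶜ ≤
      (Measure.pi ν).real {x | s ≤ f x ∧ x ∉ badEvent ν (.natural hN) Γ γ} := by
  refine harris_le hcard (fun x y hxy hx => le_trans hx (hmono x y hxy).1) fun x y hxy hx => ?_
  rw [Set.mem_compl_iff, notMem_badEvent] at hx ⊢
  exact ⟨(hmono x y hxy).2 hx.1, fun i hi =>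
    (condBad_le_of_zeroOneLE hΓ (fun x y h => (hmono x y h).2) hxy).trans (hx.2 i hi)⟩

lemma tail_mul_le_of_sameMonotonicity (hN : 0 < N) (hcard : ∀ k, Nat.card (Λ k) = 2)
    {Γ : Set (∀ k, Λ k)} {γ : Fin N → ℝ} {f : (∀ k, Λ k) → ℝ} (hΓ : MeasurableSet Γ)
    (hmono : SameMonotonicity one Γ f) (s : ℝ) :
    (Measure.pi ν).real {x | s ≤ f x} *
        (Measure.pi ν).real (badEvent ν (.natural hN) Γ γ)ᶜ ≤
      (Measure.pi ν).real {x | s ≤ f x ∧ x ∉ badEvent ν (.natural hN) Γ γ} := by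
  rcases hmono with hinc | hdec
  · exact tail_mul_le_of_increasing hN hcard hΓ hinc s
  -- Exchanging the names of the two values reverses the order and turns decreasing into increasing.
  · choose zero hne hall using fun k => exists_other_of_card_two (hcard k) (one k)
    refine tail_mul_le_of_increasing (one := zero) hN hcard hΓ (fun x y hxy => hdec y x ?_) s
    intro k hk
    rcases hall k (x k) with h | h
    · exact h
    · exact absurd ((hxy k h).symm.trans hk) (hne k)

end Correlation

end DynamicExposure

/-! ### Assembly -/

theorem mainTheorem6 {N : ℕ} (hN : 0 < N)
    {Λ : Fin N → Type*} [∀ k, MeasurableSpace (Λ k)] [∀ k, MeasurableSingletonClass (Λ k)]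
    {Ω : Type*} [MeasurableSpace Ω] (P : Measure Ω) [IsProbabilityMeasure P]
    (X : ∀ k, Ω → Λ k) (hX : ∀ k, Measurable (X k)) (hind : iIndepFun X P) :
    -- any strategy: the inequalities without a bad event
    (∀ σ : DynamicExposure.QueryStrategy Λ, DynamicExposure.BoundedDifferencesTails P X σ) ∧
    -- any strategy: the inequalities with a bad event, which may depend on the strategy
    (∀ (σ : DynamicExposure.QueryStrategy Λ) (Γ : Set (∀ k, Λ k)), MeasurableSet Γ →
      ∀ γ : ℝ, 0 < γ → γ ≤ 1 →
        ∃ B : Set (∀ k, Λ k), MeasurableSet B ∧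
          DynamicExposure.probIn P X B ≤
            (σ.maxSum fun _ => γ⁻¹) * DynamicExposure.probIn P X Γᶜ ∧
          Bᶜ ⊆ Γ ∧
          DynamicExposure.TypicalTails P X σ Γ (fun _ => γ) B) ∧
    -- monotone strategies: the bad event does not depend on the strategy
    (∀ Γ : Set (∀ k, Λ k), MeasurableSet Γ →
      ∀ γ : Fin N → ℝ, (∀ k, 0 < γ k ∧ γ k ≤ 1) →
        ∃ B : Set (∀ k, Λ k), MeasurableSet B ∧
          DynamicExposure.probIn P X B ≤
            (∑ k, (γ k)⁻¹) * DynamicExposure.probIn P X Γᶜ ∧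
          Bᶜ ⊆ Γ ∧
          (∀ σ : DynamicExposure.QueryStrategy Λ, σ.IsMonotone →
            DynamicExposure.TypicalTails P X σ Γ γ B) ∧
          -- monotone functions of `0`-`1` variables
          (∀ one : ∀ k, Λ k, (∀ k, Nat.card (Λ k) = 2) →
            ∀ f : (∀ k, Λ k) → ℝ, DynamicExposure.SameMonotonicity one Γ f →
            ∀ t : ℝ, 0 ≤ t → DynamicExposure.probIn P X B < 1 →
              DynamicExposure.tail P X f t ≤
                DynamicExposure.tailOff P X f B t / (1 - DynamicExposure.probIn P X B))) := by
  have hprob : ∀ k, IsProbabilityMeasure (P.map (X k)) := fun k =>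
    Measure.isProbabilityMeasure_map (hX k).aemeasurable
  refine ⟨DynamicExposure.boundedDifferencesTails hX hind, fun σ Γ hΓ γ hγ hγ1 => ?_,
    fun Γ hΓ γ hγ => ?_⟩
  · have hB := DynamicExposure.measurableSet_badEvent (ν := fun k => P.map (X k)) (τ := σ)
      (γ := fun _ => γ) hΓ
    refine ⟨_, hB, ?_, fun x hx => (DynamicExposure.notMem_badEvent.1 hx).1, ?_⟩
    · rw [DynamicExposure.probIn_eq hX hind hB, DynamicExposure.probIn_eq hX hind hΓ.compl]
      exact DynamicExposure.measureReal_badEvent_le_maxSum σ hΓ hγ hγ1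
    · exact DynamicExposure.typicalTails_of_good hX hind σ.refines_self hΓ (fun _ => hγ.le) hB
        (fun x hx => (DynamicExposure.notMem_badEvent.1 hx).1)
        fun x hx => (DynamicExposure.notMem_badEvent.1 hx).2
  · have hB := DynamicExposure.measurableSet_badEvent (ν := fun k => P.map (X k))
      (τ := .natural hN) (γ := γ) hΓ
    refine ⟨_, hB, ?_, fun x hx => (DynamicExposure.notMem_badEvent.1 hx).1, fun σ hσ => ?_,
      fun one hcard f hmono t _ hB1 => ?_⟩
    · rw [DynamicExposure.probIn_eq hX hind hB, DynamicExposure.probIn_eq hX hind hΓ.compl]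
      exact DynamicExposure.measureReal_badEvent_natural_le hN hΓ hγ
    · exact DynamicExposure.typicalTails_of_good hX hind (hσ.refines_natural hN) hΓ
        (fun k => (hγ k).1.le) hB (fun x hx => (DynamicExposure.notMem_badEvent.1 hx).1)
        fun x hx => (DynamicExposure.notMem_badEvent.1 hx).2
    · have hfin : ∀ k, Finite (Λ k) := fun k => (Nat.card_pos_iff.1 (by rw [hcard k]; norm_num)).2
      -- With two-point coordinates the product is finite and discrete, so measurability is
      -- automatic.
      have hf : Measurable f := .of_discrete
      rw [le_div_iff₀ (sub_pos.2 hB1), DynamicExposure.tail_eq_tailOff,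
        DynamicExposure.tailOff_eq hX hind hf .empty, DynamicExposure.tailOff_eq hX hind hf hB,
        DynamicExposure.probIn_eq hX hind hB, ← probReal_compl_eq_one_sub hB]
      simpa using DynamicExposure.tail_mul_le_of_sameMonotonicity
        (ν := fun k => P.map (X k)) hN hcard hΓ hmono _
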